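/- Let $\mathbf{FI}$ be the category of finite sets and injections; an $\mathbf{FI}$-module is a functor from $\mathbf{FI}$ to abelian groups. For an $\mathbf{FI}$-module $W$ let $\deg W\in\{-1,0,1,\dots\}\cup\{\infty\}$ be the least $d\ge -1$ such that $W_S=0$ for all finite sets $S$ with $|S|>d$. Let $\mathrm H_0(V)_S=\operatorname{coker}\bigl(\bigoplus_{A\subsetneq S}V_A\to V_S\bigr)$, let $\mathrm H_i$ be the $i$-th left derived functor of $\mathrm H_0$, and say that $V$ is presented in finite degrees if $\deg \mathrm H_0(V)$ and $\deg \mathrm H_1(V)$ are both finite. Let $\mathbf\Delta V=\operatorname{coker}(V\to \mathbf\Sigma V)$, where $(\mathbf\Sigma V)_S=V_{S\sqcup\{*\}}$ and the map is induced by the inclusions $S\hookrightarrow S\sqcup\{*\}$; let $\mathbf\Delta^a$ be the $a$-fold composite of $\mathbf\Delta$ and $\mathrm L_i\mathbf\Delta^a$ its $i$-th left derived functor. Let $\mathrm H^0_{\mathfrak m}(V)$ be the largest torsion $\mathbf{FI}$-submodule of $V$ (the elements $x\in V_S$ with $V_\alpha(x)=0$ for some injection $\alpha\colon S\hookrightarrow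 T$), let $\mathrm H^j_{\mathfrak m}$ be the $j$-th right derived functor of $\mathrm H^0_{\mathfrak m}$, and set $h^j(V)=\deg \mathrm H^j_{\mathfrak m}(V)$. Let $V$ be an $\mathbf{FI}$-module presented in finite degrees. Then: (1) For every $a\ge 0$ and $u\ge 0$, if $h^u(\mathbf\Delta^aV)\ge 0$, then $$h^u(\mathbf\Delta^aV)+u+a\le\max\{h^j(V)+j : h^j(V)\ge 0 \text{ and } 0\le j\le u+a\}.$$ (2) For every $a\ge 1$ and $i\ge 1$, if $\mathrm L_i\mathbf\Delta^a(V)\ne 0$, then $$\deg \mathrm L_i\mathbf\Delta^a(V)+a\le\max\{h^j(V)+j+i : h^j(V)\ge 0 \text{ and } 0\le j\le a-i\}.$$ In both parts the set on the right-hand side is, under the stated hypothesis, nonempty. -/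

import Mathlib

open CategoryTheory CategoryTheory.Limits

universe u

/-- Objects of the category `FI`: finite sets. -/
structure FI : Type (u + 1) where
  carrier : Type u
  finite : Finite carrier

namespace FI

instance (S : FI.{u}) : Finite S.carrier := S.finite

/-- Morphisms of `FI` are injections. -/
instance : Category.{u} FI.{u} where
  Hom S T := S.carrier ↪ T.carrier
  id S := Function.Embedding.refl S.carrier
  comp f g := Function.Embedding.trans f g

/-- A subset of a finite set, as a finite set. -/
def sub {S : FI.{u}} (A : Set S.carrier) : FI.{u} := ⟨A, inferInstance⟩

/-- The inclusion of a subset. -/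
def incl {S : FI.{u}} (A : Set S.carrier) : sub A ⟶ S := Function.Embedding.subtype (· ∈ A)

/-- The functor `S ↦ S ⊔ {*}`. -/
def addPoint : FI.{u} ⥤ FI.{u} where
  obj S := ⟨Option S.carrier, inferInstance⟩
  map f := Function.Embedding.optionMap f
  map_id S := by
    apply Function.Embedding.ext
    rintro (_ | x) <;> rfl
  map_comp f g := by
    apply Function.Embedding.ext
    rintro (_ | x) <;> rfl

/-- The natural inclusion `S ⊆ S ⊔ {*}`. -/
def inclPoint : 𝟭 FI.{u} ⟶ addPoint where
  app S := (Function.Embedding.some : S.carrier ↪ Option S.carrier)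
  naturality S T f := by
    apply Function.Embedding.ext
    intro x
    rfl

/-- Two injections out of `S` can be completed to a commutative square. -/
lemma exists_square {S T U : FI.{u}} (f : S ⟶ T) (g : S ⟶ U) :
    ∃ (W : FI.{u}) (p : T ⟶ W) (q : U ⟶ W), f ≫ p = g ≫ q := by
  classical
  let f' : S.carrier ↪ T.carrier := f
  let g' : S.carrier ↪ U.carrier := g
  let q : U.carrier → T.carrier ⊕ U.carrier := fun y =>
    if h : ∃ x, g' x = y then Sum.inl (f' h.choose) else Sum.inr y
  have hq : ∀ x, q (g' x) = Sum.inl (f' x) := by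
    intro x
    have h : ∃ x', g' x' = g' x := ⟨x, rfl⟩
    have : h.choose = x := g'.injective h.choose_spec
    simp only [q, dif_pos h, this]
  have qinj : Function.Injective q := by
    intro y z hyz
    by_cases hy : ∃ x, g' x = y <;> by_cases hz : ∃ x, g' x = z
    · obtain ⟨x, rfl⟩ := hy
      obtain ⟨x', rfl⟩ := hz
      rw [hq, hq] at hyz
      rw [f'.injective (Sum.inl.inj hyz)]
    · obtain ⟨x, rfl⟩ := hy
      rw [hq] at hyz
      simp [q, dif_neg hz] at hyz
    · obtain ⟨x', rfl⟩ := hz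
      rw [hq] at hyz
      simp [q, dif_neg hy] at hyz
    · simpa [q, dif_neg hy, dif_neg hz] using hyz
  refine ⟨⟨T.carrier ⊕ U.carrier, inferInstance⟩, ⟨Sum.inl, Sum.inl_injective⟩, ⟨q, qinj⟩, ?_⟩
  apply Function.Embedding.ext
  intro x
  exact (hq x).symm

end FI

/-- The category of `FI`-modules: functors from `FI` to `R`-modules. The case `R = ℤ` gives
functors to abelian groups. -/
abbrev FIMod (R : Type) [CommRing R] : Type (u + 1) := FI.{u} ⥤ ModuleCat.{u} R

namespace FIMod

section

variable {R : Type} [CommRing R]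

/-! ### The category of `FI`-modules has enough projectives and enough injectives -/

/-- The finite sets `{0, …, n - 1}`, as a family of objects of `FI`. -/
def std : Discrete (ULift.{u} ℕ) ⥤ FI.{u} :=
  Discrete.functor fun n => ⟨ULift.{u} (Fin n.down), inferInstance⟩

lemma exists_iso_std (S : FI.{u}) : ∃ n, Nonempty (std.obj n ≅ S) := by
  have := S.finite
  let e : S.carrier ≃ ULift.{u} (Fin (Nat.card S.carrier)) :=
    (Finite.equivFin S.carrier).trans Equiv.ulift.symm
  refine ⟨⟨⟨Nat.card S.carrier⟩⟩, ⟨⟨e.symm.toEmbedding, e.toEmbedding, ?_, ?_⟩⟩⟩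
  · apply Function.Embedding.ext
    intro x
    exact e.apply_symm_apply x
  · apply Function.Embedding.ext
    intro x
    exact e.symm_apply_apply x

variable (R) in
/-- Restriction of `FI`-modules to the objects `{0, …, n - 1}`. -/
abbrev res : FIMod.{u} R ⥤ (Discrete (ULift.{u} ℕ) ⥤ ModuleCat.{u} R) :=
  (Functor.whiskeringLeft _ _ _).obj std

instance : (res.{u} R).Faithful where
  map_injective {V W f g} h := by
    ext1
    funext S
    obtain ⟨n, ⟨e⟩⟩ := exists_iso_std S
    have hn : f.app (std.obj n) = g.app (std.obj n) := congr_arg (fun t => t.app n) h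
    rw [← cancel_epi (V.map e.hom), f.naturality, g.naturality, hn]

instance {ι : Type u} : EnoughInjectives (Discrete ι ⥤ ModuleCat.{u} R) where
  presentation X := by
    refine ⟨⟨Discrete.functor fun i => Injective.under (X.obj ⟨i⟩), ⟨?_⟩,
      Discrete.natTrans fun i => Injective.ι (X.obj i), ?_⟩⟩
    · intro Y Z g f hf
      have hf' : ∀ i, Mono (f.app i) := fun i => inferInstance
      refine ⟨Discrete.natTrans fun i =>
        (Injective.factorThru (J := Injective.under (X.obj ⟨i.as⟩)) (g.app i) (f.app i)), ?_⟩
      ext1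
      funext i
      exact Injective.comp_factorThru (J := Injective.under (X.obj ⟨i.as⟩)) _ _
    · have : ∀ i, Mono ((Discrete.natTrans (F := X)
          (G := Discrete.functor fun i => Injective.under (X.obj ⟨i⟩))
          fun i => Injective.ι (X.obj i)).app i) := fun i =>
        inferInstanceAs (Mono (Injective.ι (X.obj i)))
      exact NatTrans.mono_of_mono_app _

instance {ι : Type u} : EnoughProjectives (Discrete ι ⥤ ModuleCat.{u} R) where
  presentation X := by
    refine ⟨{ p := Discrete.functor fun i => Projective.over (X.obj ⟨i⟩)
              f := Discrete.natTrans fun i => Projective.π (X.obj i)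
              projective := ⟨?_⟩
              epi := ?_ }⟩
    · intro Y Z g f hf
      have hf' : ∀ i, Epi (f.app i) := fun i => inferInstance
      refine ⟨Discrete.natTrans fun i =>
        (Projective.factorThru (P := Projective.over (X.obj ⟨i.as⟩)) (g.app i) (f.app i)), ?_⟩
      ext1
      funext i
      exact Projective.factorThru_comp (P := Projective.over (X.obj ⟨i.as⟩)) _ _
    · have : ∀ i, Epi ((Discrete.natTrans
          (F := Discrete.functor fun i => Projective.over (X.obj ⟨i⟩)) (G := X)
          fun i => Projective.π (X.obj i)).app i) := fun i =>
        inferInstanceAs (Epi (Projective.π (X.obj i)))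
      exact NatTrans.epi_of_epi_app _

instance : EnoughInjectives (FIMod.{u} R) :=
  EnoughInjectives.of_adjunction (std.{u}.ranAdjunction (ModuleCat.{u} R))

instance : EnoughProjectives (FIMod.{u} R) where
  presentation V := by
    let adj := std.{u}.lanAdjunction (ModuleCat.{u} R)
    let P := Projective.over ((res.{u} R).obj V)
    have hP : Projective (std.{u}.lan.obj P) := adj.map_projective P inferInstance
    let q : std.{u}.lan.obj P ⟶ V := std.{u}.lan.map (Projective.π ((res.{u} R).obj V)) ≫ adj.counit.app V
    have : Epi (std.{u}.lan.map (Projective.π ((res.{u} R).obj V))) :=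
      have := adj.isLeftAdjoint
      inferInstance
    have : Epi (adj.counit.app V) := inferInstance
    exact ⟨{ p := _, f := q, projective := hP, epi := epi_comp _ _ }⟩

/-! ### Degree -/

/-- The least `d ≥ -1` (possibly `∞`) such that `W` vanishes on all finite sets with more than
`d` elements. -/
noncomputable def deg (W : FIMod.{u} R) : WithTop ℤ :=
  sInf {d : WithTop ℤ | -1 ≤ d ∧
    ∀ S : FI.{u}, d < (Nat.card S.carrier : WithTop ℤ) → IsZero (W.obj S)}

/-! ### `FI`-homology -/

/-- The image of `⨁_{A ⊊ S} V_A → V_S`. -/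
def fromProper (V : FIMod.{u} R) (S : FI.{u}) : Submodule R (V.obj S) :=
  ⨆ (A : Set S.carrier) (_ : A ≠ Set.univ), LinearMap.range (V.map (FI.incl A)).hom

lemma fromProper_le_comap (V : FIMod.{u} R) {S T : FI.{u}} (f : S ⟶ T) :
    fromProper V S ≤ (fromProper V T).comap (V.map f).hom := by
  refine iSup₂_le fun A hA => ?_
  let f' : S.carrier ↪ T.carrier := f
  let B : Set T.carrier := f' '' A
  have hB : B ≠ Set.univ := by
    intro h
    apply hA
    ext x
    simp only [Set.mem_univ, iff_true]
    have hx : f' x ∈ B := h ▸ Set.mem_univ _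
    obtain ⟨y, hy, hxy⟩ := hx
    exact f'.injective hxy ▸ hy
  let g : FI.sub A ⟶ FI.sub B :=
    (⟨fun x => ⟨f' x.1, x.1, x.2, rfl⟩, fun x y h =>
      Subtype.ext (f'.injective (congr_arg Subtype.val h))⟩ : A ↪ B)
  have hfg : FI.incl A ≫ f = g ≫ FI.incl B := by
    apply Function.Embedding.ext
    intro x
    rfl
  rintro _ ⟨x, rfl⟩
  have h1 : (V.map f).hom ((V.map (FI.incl A)).hom x) =
      (V.map (FI.incl B)).hom ((V.map g).hom x) := by
    rw [← LinearMap.comp_apply, ← LinearMap.comp_apply, ← ModuleCat.hom_comp,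
      ← ModuleCat.hom_comp, ← V.map_comp, ← V.map_comp, hfg]
  rw [Submodule.mem_comap, h1]
  exact le_iSup₂ (f := fun (A : Set T.carrier) (_ : A ≠ Set.univ) =>
    LinearMap.range (V.map (FI.incl A)).hom) B hB ⟨_, rfl⟩

lemma fromProper_le_comap_app {V W : FIMod.{u} R} (φ : V ⟶ W) (S : FI.{u}) :
    fromProper V S ≤ (fromProper W S).comap (φ.app S).hom := by
  refine iSup₂_le fun A hA => ?_
  rintro _ ⟨x, rfl⟩
  have h1 : (φ.app S).hom ((V.map (FI.incl A)).hom x) =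
      (W.map (FI.incl A)).hom ((φ.app _).hom x) := by
    rw [← LinearMap.comp_apply, ← LinearMap.comp_apply, ← ModuleCat.hom_comp,
      ← ModuleCat.hom_comp, φ.naturality]
  rw [Submodule.mem_comap, h1]
  exact le_iSup₂ (f := fun (A : Set S.carrier) (_ : A ≠ Set.univ) =>
    LinearMap.range (W.map (FI.incl A)).hom) A hA ⟨_, rfl⟩

/-- The functor `V ↦ (S ↦ coker (⨁_{A ⊊ S} V_A → V_S))`. -/
def homologyZero (R : Type) [CommRing R] : FIMod.{u} R ⥤ FIMod.{u} R where
  obj V :=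
    { obj := fun S => ModuleCat.of R (V.obj S ⧸ fromProper V S)
      map := fun f => ModuleCat.ofHom (Submodule.mapQ _ _ (V.map f).hom (fromProper_le_comap V f))
      map_id := fun S => by
        ext x
        simp
      map_comp := fun f g => by
        ext x
        simp }
  map φ :=
    { app := fun S => ModuleCat.ofHom
        (Submodule.mapQ _ _ (φ.app S).hom (fromProper_le_comap_app φ S))
      naturality := fun S T f => by
        ext x
        have h := congr_arg (fun t => t.hom x) (φ.naturality f)
        simp only [ModuleCat.hom_comp, LinearMap.comp_apply] at h
        simp [h] }
  map_id V := by
    ext S x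
    simp
  map_comp φ ψ := by
    ext S x
    simp

instance : (homologyZero.{u} R).Additive where
  map_add {V W φ ψ} := by
    ext S x
    obtain ⟨x, rfl⟩ := Submodule.mkQ_surjective _ x
    rfl

/-- `FI`-homology: the left derived functors of `homologyZero`. -/
noncomputable def homology (R : Type) [CommRing R] (i : ℕ) : FIMod.{u} R ⥤ FIMod.{u} R := (homologyZero R).leftDerived i

/-- `t_i(V)`, the degree of the `i`-th `FI`-homology. -/
noncomputable def t (i : ℕ) (V : FIMod.{u} R) : WithTop ℤ := deg ((homology R i).obj V)

/-- `V` is presented in finite degrees: `t_0(V)` and `t_1(V)` are finite. -/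
def PresentedInFiniteDegrees (V : FIMod.{u} R) : Prop := t 0 V ≠ ⊤ ∧ t 1 V ≠ ⊤

/-! ### Shift, derivative, and derived iterated derivatives -/

/-- The shift functor: precomposition with `S ↦ S ⊔ {*}`. -/
abbrev shift (R : Type) [CommRing R] : FIMod.{u} R ⥤ FIMod.{u} R := (Functor.whiskeringLeft _ _ _).obj FI.addPoint

/-- The natural transformation from the identity to the shift induced by `S ⊆ S ⊔ {*}`. -/
def toShift (R : Type) [CommRing R] : 𝟭 (FIMod.{u} R) ⟶ shift R where
  app V := { app := fun S => V.map (FI.inclPoint.app S)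
             naturality := fun S T f => by
               change V.map f ≫ V.map _ = V.map _ ≫ V.map (FI.addPoint.map f)
               rw [← V.map_comp, ← V.map_comp]
               exact congr_arg V.map (FI.inclPoint.naturality f) }
  naturality V W φ := by
    ext1
    funext S
    exact (φ.naturality (FI.inclPoint.app S)).symm

/-- The derivative functor: the cokernel of `toShift`. -/
noncomputable def derivative (R : Type) [CommRing R] : FIMod.{u} R ⥤ FIMod.{u} R where
  obj V := cokernel ((toShift R).app V)
  map {V W} φ := cokernel.map ((toShift R).app V) ((toShift R).app W) φ ((shift R).map φ)
    ((toShift R).naturality φ).symm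
  map_id V := by
    rw [← cancel_epi (cokernel.π ((toShift R).app V))]
    simp
  map_comp {V W X} φ ψ := by
    refine (cancel_epi (cokernel.π ((toShift R).app V))).1 ?_
    simp

instance : (derivative.{u} R).Additive where
  map_add {V W φ ψ} := by
    refine (cancel_epi (cokernel.π ((toShift R).app V))).1 ?_
    have e (χ : V ⟶ W) : cokernel.π ((toShift R).app V) ≫ (derivative.{u} R).map χ =
        (shift R).map χ ≫ cokernel.π ((toShift R).app W) := cokernel.π_desc _ _ _
    refine (e (φ + ψ)).trans ?_
    refine Eq.trans ?_ (Preadditive.comp_add _ _ _ _ _ _).symm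
    rw [e φ, e ψ]
    exact Preadditive.add_comp _ _ _ ((shift R).map φ) ((shift R).map ψ) _

/-- The `a`-fold composite of the derivative functor. -/
noncomputable def iterDerivative (R : Type) [CommRing R] : ℕ → (FIMod.{u} R ⥤ FIMod.{u} R)
  | 0 => 𝟭 _
  | a + 1 => iterDerivative R a ⋙ derivative R

instance iterDerivative_additive : ∀ a : ℕ, (iterDerivative.{u} R a).Additive
  | 0 => inferInstanceAs (𝟭 (FIMod.{u} R)).Additive
  | a + 1 =>
    have := iterDerivative_additive a
    inferInstanceAs (iterDerivative.{u} R a ⋙ derivative R).Additive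

/-- The `i`-th left derived functor of the `a`-fold derivative. -/
noncomputable def derivedDerivative (R : Type) [CommRing R] (a i : ℕ) : FIMod.{u} R ⥤ FIMod.{u} R :=
  (iterDerivative R a).leftDerived i

/-! ### Torsion and local cohomology -/

/-- The elements of `V_S` killed by some injection `S ↪ T`. -/
def torsionAt (V : FIMod.{u} R) (S : FI.{u}) : Submodule R (V.obj S) where
  carrier := {x | ∃ (T : FI.{u}) (α : S ⟶ T), (V.map α).hom x = 0}
  zero_mem' := ⟨S, 𝟙 S, map_zero _⟩
  add_mem' := by
    rintro x y ⟨T, α, hx⟩ ⟨U, β, hy⟩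
    obtain ⟨W, p, q, h⟩ := FI.exists_square α β
    refine ⟨W, α ≫ p, ?_⟩
    rw [map_add]
    nth_rewrite 2 [h]
    simp [hx, hy]
  smul_mem' := by
    rintro c x ⟨T, α, hx⟩
    exact ⟨T, α, by rw [map_smul, hx, smul_zero]⟩

lemma torsionAt_map (V : FIMod.{u} R) {S T : FI.{u}} (f : S ⟶ T) :
    ∀ x ∈ torsionAt V S, (V.map f).hom x ∈ torsionAt V T := by
  rintro x ⟨U, α, hx⟩
  obtain ⟨W, p, q, h⟩ := FI.exists_square f α
  refine ⟨W, p, ?_⟩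
  rw [← LinearMap.comp_apply, ← ModuleCat.hom_comp, ← V.map_comp, h]
  simp [hx]

lemma torsionAt_app {V W : FIMod.{u} R} (φ : V ⟶ W) (S : FI.{u}) :
    ∀ x ∈ torsionAt V S, (φ.app S).hom x ∈ torsionAt W S := by
  rintro x ⟨T, α, hx⟩
  refine ⟨T, α, ?_⟩
  rw [← LinearMap.comp_apply, ← ModuleCat.hom_comp, ← φ.naturality, ModuleCat.hom_comp,
    LinearMap.comp_apply, hx, map_zero]

/-- The functor sending an `FI`-module to its largest torsion submodule. -/
def torsion (R : Type) [CommRing R] : FIMod.{u} R ⥤ FIMod.{u} R where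
  obj V :=
    { obj := fun S => ModuleCat.of R (torsionAt V S)
      map := fun f => ModuleCat.ofHom ((V.map f).hom.restrict (torsionAt_map V f))
      map_id := fun S => by
        ext x
        simp [LinearMap.restrict_apply]
      map_comp := fun f g => by
        ext x
        simp [LinearMap.restrict_apply] }
  map φ :=
    { app := fun S => ModuleCat.ofHom ((φ.app S).hom.restrict (torsionAt_app φ S))
      naturality := fun S T f => by
        ext x
        have h := congr_arg (fun t => t.hom x.1) (φ.naturality f)
        simp only [ModuleCat.hom_comp, LinearMap.comp_apply] at h
        simp [LinearMap.restrict_apply, h] }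
  map_id V := by
    ext S x
    simp [LinearMap.restrict_apply]
  map_comp φ ψ := by
    ext S x
    simp [LinearMap.restrict_apply]

instance : (torsion.{u} R).Additive where
  map_add {V W φ ψ} := by
    ext S x
    rfl

/-- Local cohomology: the right derived functors of `torsion`. -/
noncomputable def localCohomology (R : Type) [CommRing R] (j : ℕ) : FIMod.{u} R ⥤ FIMod.{u} R := (torsion R).rightDerived j

/-- `h^j(V)`, the degree of the `j`-th local cohomology. -/
noncomputable def h (j : ℕ) (V : FIMod.{u} R) : WithTop ℤ := deg ((localCohomology R j).obj V)

end

end FIMod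

/-!
Let `K = ker (V ⟶ ΣV)`. When `V` is presented in finite degrees, `K` is bounded and so has no local
cohomology in positive degrees; the exact sequence `0 ⟶ K ⟶ V ⟶ ΣV ⟶ ΔV ⟶ 0` and the isomorphism
`H^j(ΣV)_S ≅ H^j(V)_{S ⊔ *}` then show that `H^j(ΔV)_S` vanishes as soon as `H^j(V)_{S ⊔ *}` and
`H^{j+1}(V)_S` do. Similarly, `(L_i Δ^{a+1} V)_S` vanishes as soon as `(L_i Δ^a V)_{S ⊔ *}` and
`(L_{i-1} Δ^a V)_S` do, where for `i = 1` the latter is replaced by the torsion of `(Δ^a V)_S`.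
Tracing a nonzero value back through `a` derivatives, each of them costs one point of the set, one
cohomological degree, or one homological degree: these are the two inequalities.

The boundedness of `K` for all the modules `Δ^a V` comes from an epimorphism `P ⟶ V` with kernel
`N`, where `P` and `N` are generated in finite degrees and `P ⟶ ΣP` splits. The kernel of `ΔN ⟶ ΔP`
is `K`, and `Δ` lowers the degrees in which `P` is generated, which allows for an induction.
-/

/-! ### Dimension shifting for derived functors -/

section DerivedFunctors

variable {C D E : Type*} [Category* C] [Category* D] [Category* E]
  [Abelian C] [Abelian D] [Abelian E]

section KernelsAndCokernels

variable {X Y Z : C} (f : X ⟶ Y) (g : Y ⟶ Z)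

lemma shortExact_kernel [Epi f] :
    (ShortComplex.mk (kernel.ι f) f (kernel.condition f)).ShortExact where
  exact := ShortComplex.exact_kernel f
  mono_f := inferInstanceAs (Mono (kernel.ι f))
  epi_g := ‹Epi f›

lemma shortExact_cokernel [Mono f] :
    (ShortComplex.mk f (cokernel.π f) (cokernel.condition f)).ShortExact where
  exact := ShortComplex.exact_cokernel f
  mono_f := ‹Mono f›
  epi_g := inferInstanceAs (Epi (cokernel.π f))

lemma shortExact_kernel_map_comp [Epi f] :
    (ShortComplex.mk (kernel.map f (f ≫ g) (𝟙 _) g (by simp))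
      (kernel.map (f ≫ g) g f (𝟙 _) (by simp)) (by ext; simp)).ShortExact where
  exact := (kernelCokernelCompSequence_exact f g).exact 0
  mono_f := mono_of_mono_fac (kernel.lift_ι _ _ _ |>.trans (Category.comp_id _))
  epi_g := by
    have h := (kernelCokernelCompSequence_exact f g).exact 1
    exact h.epi_f ((isZero_cokernel_of_epi f).eq_zero_of_tgt _)

lemma shortExact_cokernel_map_comp [Mono g] :
    (ShortComplex.mk (cokernel.map f (f ≫ g) (𝟙 _) g (by simp))
      (cokernel.map (f ≫ g) g f (𝟙 _) (by simp)) (by ext; simp)).ShortExact where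
  exact := (kernelCokernelCompSequence_exact f g).exact 3
  mono_f := by
    have h := (kernelCokernelCompSequence_exact f g).exact 2
    exact h.mono_g ((isZero_kernel_of_mono g).eq_zero_of_src _)
  epi_g := epi_of_epi_fac (cokernel.π_desc _ _ _ |>.trans (Category.id_comp _))

end KernelsAndCokernels

lemma exact_comp_left_iff_epi {S : ShortComplex C} (hS : S.Exact) [Mono S.f] {A : C}
    (p : A ⟶ S.X₁) : (ShortComplex.mk (p ≫ S.f) S.g (by simp)).Exact ↔ Epi p := by
  have := hS.epi_kernelLift
  have : Mono (kernel.lift S.g S.f S.zero) := mono_of_mono_fac (kernel.lift_ι _ _ _)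
  have : IsIso (kernel.lift S.g S.f S.zero) := isIso_of_mono_of_epi _
  have hp : kernel.lift S.g (p ≫ S.f) (by simp) = p ≫ kernel.lift S.g S.f S.zero := by
    ext; simp
  rw [ShortComplex.exact_iff_epi_kernel_lift, hp, epi_comp_iff_of_isIso]

lemma exact_comp_right_iff_mono {S : ShortComplex C} (hS : S.Exact) [Epi S.g] {A : C}
    (i : S.X₃ ⟶ A) : (ShortComplex.mk S.f (S.g ≫ i) (by simp)).Exact ↔ Mono i := by
  have := hS.mono_cokernelDesc
  have : Epi (cokernel.desc S.f S.g S.zero) := epi_of_epi_fac (cokernel.π_desc _ _ _)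
  have : IsIso (cokernel.desc S.f S.g S.zero) := isIso_of_mono_of_epi _
  have hi : cokernel.desc S.f (S.g ≫ i) (by simp) = cokernel.desc S.f S.g S.zero ≫ i := by
    ext; simp
  rw [ShortComplex.exact_iff_mono_cokernel_desc, hi, mono_comp_iff_of_isIso]

/-- A complex of injective objects, exact in positive degrees and augmented by the kernel of its
first differential, as an injective resolution. -/
noncomputable def injectiveResolutionOfExact {Z : C} (K : CochainComplex C ℕ)
    [∀ n, Injective (K.X n)] (ε : Z ⟶ K.X 0) (w : ε ≫ K.d 0 1 = 0)
    (ε_mono : Mono ε) (hε : (ShortComplex.mk ε (K.d 0 1) w).Exact) (hK : ∀ n, K.ExactAt (n + 1)) :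
    InjectiveResolution Z where
  cocomplex := K
  ι := (CochainComplex.fromSingle₀Equiv _ _).symm ⟨ε, w⟩
  quasiIso := ⟨fun n => by
    cases n with
    | zero =>
      rw [CochainComplex.quasiIsoAt₀_iff, ShortComplex.quasiIso_iff_of_zeros]
      · refine (ShortComplex.exact_and_mono_f_iff_of_iso (S₂ := ShortComplex.mk ε _ w)
          ?_).2 ⟨hε, ε_mono⟩
        refine ShortComplex.isoMk (Iso.refl _) (Iso.refl _) (Iso.refl _) ?_ ?_
        · exact (Category.id_comp ε).trans ((Category.comp_id _).trans
            (CochainComplex.fromSingle₀Equiv_symm_apply_f_zero ε w)).symm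
        · exact (Category.id_comp (K.d 0 1)).trans (Category.comp_id _).symm
      · rfl
      · rfl
      · exact K.shape 0 0 (by simp)
    | succ n =>
      rw [quasiIsoAt_iff_exactAt _ _ (CochainComplex.exactAt_succ_single_obj _ _)]
      exact hK n⟩

/-- A complex of projective objects, exact in positive degrees and augmented by the cokernel of
its last differential, as a projective resolution. -/
noncomputable def projectiveResolutionOfExact {Z : C} (K : ChainComplex C ℕ)
    [∀ n, Projective (K.X n)] (ε : K.X 0 ⟶ Z) (w : K.d 1 0 ≫ ε = 0)
    (ε_epi : Epi ε) (hε : (ShortComplex.mk (K.d 1 0) ε w).Exact) (hK : ∀ n, K.ExactAt (n + 1)) :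
    ProjectiveResolution Z where
  complex := K
  π := (ChainComplex.toSingle₀Equiv _ _).symm ⟨ε, w⟩
  quasiIso := ⟨fun n => by
    cases n with
    | zero =>
      rw [ChainComplex.quasiIsoAt₀_iff, ShortComplex.quasiIso_iff_of_zeros']
      · refine (ShortComplex.exact_and_epi_g_iff_of_iso (S₂ := ShortComplex.mk _ ε w)
          ?_).2 ⟨hε, ε_epi⟩
        refine ShortComplex.isoMk (Iso.refl _) (Iso.refl _) (Iso.refl _) ?_ ?_
        · exact (Category.id_comp (K.d 1 0)).trans (Category.comp_id _).symm
        · exact (Category.id_comp ε).trans ((Category.comp_id _).trans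
            (ChainComplex.toSingle₀Equiv_symm_apply_f_zero ε w)).symm
      · exact K.shape 0 0 (by simp)
      · rfl
      · rfl
    | succ n =>
      rw [quasiIsoAt_iff_exactAt' _ _ (ChainComplex.exactAt_succ_single_obj _ _)]
      exact hK n⟩

/-- An injective resolution of the cokernel of a monomorphism into an injective object, preceded
by that object: an injective resolution of the source. -/
noncomputable def injectiveResolutionSplice {S : ShortComplex C} (hS : S.ShortExact)
    [Injective S.X₂] (J : InjectiveResolution S.X₃) : InjectiveResolution S.X₁ :=
  let ε : S.X₃ ⟶ J.cocomplex.X 0 := J.ι.f 0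
  have hε : ε ≫ J.cocomplex.d 0 1 = 0 := J.ι_f_zero_comp_complex_d
  have ε_mono : Mono ε := inferInstanceAs (Mono (J.ι.f 0))
  have f_mono : Mono S.f := hS.mono_f
  have g_epi : Epi S.g := hS.epi_g
  let K : CochainComplex C ℕ := J.cocomplex.augment (S.g ≫ ε) (by simp [hε])
  have (n : ℕ) : Injective (K.X n) :=
    match n with
    | 0 => ‹Injective S.X₂›
    | n + 1 => J.injective n
  injectiveResolutionOfExact K S.f (S.zero_assoc ε |>.trans zero_comp) f_mono
    ((exact_comp_right_iff_mono hS.exact ε).2 ε_mono) fun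
    | 0 => by
      rw [HomologicalComplex.exactAt_iff' _ 0 1 2 (by simp) (by simp)]
      exact (exact_comp_left_iff_epi (S := ShortComplex.mk ε _ hε) J.exact₀ S.g).2 g_epi
    | n + 1 => by
      rw [HomologicalComplex.exactAt_iff' _ (n + 1) (n + 2) (n + 3) (by simp) (by simp)]
      exact J.exact_succ n

/-- A projective resolution of the kernel of an epimorphism from a projective object, followed by
that object: a projective resolution of the target. -/
noncomputable def projectiveResolutionSplice {S : ShortComplex C} (hS : S.ShortExact)
    [Projective S.X₂] (P : ProjectiveResolution S.X₁) : ProjectiveResolution S.X₃ :=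
  let ε : P.complex.X 0 ⟶ S.X₁ := P.π.f 0
  have hε : P.complex.d 1 0 ≫ ε = 0 := P.complex_d_comp_π_f_zero
  have ε_epi : Epi ε := inferInstanceAs (Epi (P.π.f 0))
  have f_mono : Mono S.f := hS.mono_f
  have g_epi : Epi S.g := hS.epi_g
  let K : ChainComplex C ℕ := P.complex.augment (ε ≫ S.f) (by simp [reassoc_of% hε])
  have (n : ℕ) : Projective (K.X n) :=
    match n with
    | 0 => ‹Projective S.X₂›
    | n + 1 => P.projective n
  projectiveResolutionOfExact K S.g (show (ε ≫ S.f) ≫ S.g = 0 by simp) g_epi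
    ((exact_comp_left_iff_epi hS.exact ε).2 ε_epi) fun
    | 0 => by
      rw [HomologicalComplex.exactAt_iff' _ 2 1 0 (by simp) (by simp)]
      exact (exact_comp_right_iff_mono (S := ShortComplex.mk _ ε hε) P.exact₀ S.f).2 f_mono
    | n + 1 => by
      rw [HomologicalComplex.exactAt_iff' _ (n + 3) (n + 2) (n + 1) (by simp) (by simp)]
      exact P.exact_succ n

section RightDerived

variable [HasInjectiveResolutions C] (F : C ⥤ D) [F.Additive]

lemma isZero_rightDerived_succ_iff_exact {X : C} (J : InjectiveResolution X) (n : ℕ) :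
    IsZero ((F.rightDerived (n + 1)).obj X) ↔
      (ShortComplex.mk (F.map (J.cocomplex.d n (n + 1))) (F.map (J.cocomplex.d (n + 1) (n + 2)))
        (by rw [← F.map_comp, J.complex_d_comp, F.map_zero])).Exact := by
  rw [(J.isoRightDerivedObj F (n + 1)).isZero_iff]
  change IsZero (HomologicalComplex.homology _ _) ↔ _
  rw [← HomologicalComplex.exactAt_iff_isZero_homology,
    HomologicalComplex.exactAt_iff' _ n (n + 1) (n + 2) (by simp) (by simp)]
  rfl

variable {S : ShortComplex C} (hS : S.ShortExact) [Injective S.X₂]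
include hS

lemma isZero_rightDerived_add_two_iff (n : ℕ) :
    IsZero ((F.rightDerived (n + 2)).obj S.X₁) ↔ IsZero ((F.rightDerived (n + 1)).obj S.X₃) := by
  let J := injectiveResolution S.X₃
  rw [isZero_rightDerived_succ_iff_exact F J,
    isZero_rightDerived_succ_iff_exact F (injectiveResolutionSplice hS J)]
  rfl

lemma isZero_rightDerived_one_iff_epi_map [PreservesFiniteLimits F] :
    IsZero ((F.rightDerived 1).obj S.X₁) ↔ Epi (F.map S.g) := by
  let J := injectiveResolution S.X₃
  let T : ShortComplex C := ShortComplex.mk (J.ι.f 0) (J.cocomplex.d 0 1)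
    J.ι_f_zero_comp_complex_d
  have hT : (T.map F).Exact ∧ Mono (F.map T.f) :=
    ((F.preservesFiniteLimits_tfae.out 3 1 :).1 inferInstance) T
      ⟨J.exact₀, inferInstanceAs (Mono (J.ι.f 0))⟩
  have : Mono (T.map F).f := hT.2
  rw [isZero_rightDerived_succ_iff_exact F (injectiveResolutionSplice hS J)]
  refine Iff.trans (Eq.to_iff (congrArg ShortComplex.Exact ?_))
    (exact_comp_left_iff_epi (S := T.map F) hT.1 (F.map S.g))
  congr 1
  exact F.map_comp _ _

end RightDerived

section LeftDerived

variable [HasProjectiveResolutions C] (F : C ⥤ D) [F.Additive]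

lemma isZero_leftDerived_succ_iff_exact {X : C} (P : ProjectiveResolution X) (n : ℕ) :
    IsZero ((F.leftDerived (n + 1)).obj X) ↔
      (ShortComplex.mk (F.map (P.complex.d (n + 2) (n + 1))) (F.map (P.complex.d (n + 1) n))
        (by rw [← F.map_comp, P.complex.d_comp_d, F.map_zero])).Exact := by
  rw [(P.isoLeftDerivedObj F (n + 1)).isZero_iff]
  change IsZero (HomologicalComplex.homology _ _) ↔ _
  rw [← HomologicalComplex.exactAt_iff_isZero_homology,
    HomologicalComplex.exactAt_iff' _ (n + 2) (n + 1) n (by simp) (by simp)]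
  rfl

variable {S : ShortComplex C} (hS : S.ShortExact) [Projective S.X₂]
include hS

lemma isZero_leftDerived_add_two_iff (n : ℕ) :
    IsZero ((F.leftDerived (n + 2)).obj S.X₃) ↔ IsZero ((F.leftDerived (n + 1)).obj S.X₁) := by
  let P := projectiveResolution S.X₁
  rw [isZero_leftDerived_succ_iff_exact F P,
    isZero_leftDerived_succ_iff_exact F (projectiveResolutionSplice hS P)]
  rfl

lemma isZero_leftDerived_one_iff_mono_map [PreservesFiniteColimits F] :
    IsZero ((F.leftDerived 1).obj S.X₃) ↔ Mono (F.map S.f) := by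
  let P := projectiveResolution S.X₁
  let T : ShortComplex C := ShortComplex.mk (P.complex.d 1 0) (P.π.f 0)
    P.complex_d_comp_π_f_zero
  have hT : (T.map F).Exact ∧ Epi (F.map T.g) :=
    ((F.preservesFiniteColimits_tfae.out 3 1 :).1 inferInstance) T
      ⟨P.exact₀, inferInstanceAs (Epi (P.π.f 0))⟩
  have : Epi (T.map F).g := hT.2
  rw [isZero_leftDerived_succ_iff_exact F (projectiveResolutionSplice hS P)]
  refine Iff.trans (Eq.to_iff (congrArg ShortComplex.Exact ?_))
    (exact_comp_right_iff_mono (S := T.map F) hT.1 (F.map S.f))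
  congr 1
  exact F.map_comp _ _

end LeftDerived

section QuotientSequence

variable {S : ShortComplex C} (hS : S.ShortExact) {I : C} (i : S.X₂ ⟶ I)

/-- The sequence `B / A ⟶ I / A ⟶ I / B` attached to a short exact sequence
`0 ⟶ A ⟶ B ⟶ B / A ⟶ 0` and a morphism `B ⟶ I`. -/
noncomputable abbrev quotientSequence : ShortComplex C :=
  have := hS.epi_g
  ShortComplex.mk (hS.exact.desc (i ≫ cokernel.π (S.f ≫ i))
      ((Category.assoc _ _ _).symm.trans (cokernel.condition _)))
    (cokernel.map (S.f ≫ i) i S.f (𝟙 _) (by simp)) (by simp [← cancel_epi S.g])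

/-- The projection from `B ⟶ I ⟶ I / B` to `quotientSequence`. -/
noncomputable abbrev toQuotientSequence :
    ShortComplex.mk i (cokernel.π i) (cokernel.condition i) ⟶ quotientSequence hS i where
  τ₁ := S.g
  τ₂ := cokernel.π (S.f ≫ i)
  τ₃ := 𝟙 _
  comm₁₂ := have := hS.epi_g; hS.exact.g_desc _ _
  comm₂₃ := by simp

lemma shortExact_quotientSequence [Mono i] : (quotientSequence hS i).ShortExact := by
  have := hS.epi_g
  let e : cokernel S.f ≅ S.X₃ := (cokernelIsCokernel S.f).coconePointUniqueUpToIso hS.gIsCokernel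
  have he : cokernel.π S.f ≫ e.hom = S.g :=
    (cokernelIsCokernel S.f).comp_coconePointUniqueUpToIso_hom hS.gIsCokernel .one
  refine (ShortComplex.shortExact_iff_of_iso ?_).1 (shortExact_cokernel_map_comp S.f i)
  exact ShortComplex.isoMk e (Iso.refl _) (Iso.refl _)
    (by simp [← cancel_epi (cokernel.π S.f), reassoc_of% he]) (by simp)

end QuotientSequence

section RightDerivedVanishing

variable [EnoughInjectives C] (F : C ⥤ D) [F.Additive] [PreservesFiniteLimits F]

omit [EnoughInjectives C] in
lemma exact_map_and_mono_map {S : ShortComplex C} (hS : S.ShortExact) :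
    (S.map F).Exact ∧ Mono (S.map F).f :=
  ((F.preservesFiniteLimits_tfae.out 3 0 :).1 inferInstance) S hS

lemma isZero_rightDerived_one_iff_epi_map_cokernel {X I : C} [Injective I] (i : X ⟶ I) [Mono i] :
    IsZero ((F.rightDerived 1).obj X) ↔ Epi (F.map (cokernel.π i)) :=
  have : Injective (ShortComplex.mk i (cokernel.π i) (cokernel.condition i)).X₂ := ‹Injective I›
  isZero_rightDerived_one_iff_epi_map F (shortExact_cokernel i)

omit [PreservesFiniteLimits F] in
lemma isZero_rightDerived_add_two_iff_cokernel {X I : C} [Injective I] (i : X ⟶ I) [Mono i]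
    (n : ℕ) : IsZero ((F.rightDerived (n + 2)).obj X) ↔
      IsZero ((F.rightDerived (n + 1)).obj (cokernel i)) :=
  have : Injective (ShortComplex.mk i (cokernel.π i) (cokernel.condition i)).X₂ := ‹Injective I›
  isZero_rightDerived_add_two_iff F (shortExact_cokernel i) n

variable {S : ShortComplex C} (hS : S.ShortExact)
include hS

lemma epi_map_of_isZero_rightDerived_one (h₁ : IsZero ((F.rightDerived 1).obj S.X₁)) :
    Epi (F.map S.g) := by
  have := hS.mono_f
  let i := Injective.ι S.X₂
  have : Epi (F.map (cokernel.π (S.f ≫ i))) :=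
    (isZero_rightDerived_one_iff_epi_map_cokernel F (S.f ≫ i)).1 h₁
  exact ShortComplex.epi_of_mono_of_epi_of_mono (F.mapShortComplex.map (toQuotientSequence hS i))
    (exact_map_and_mono_map F (shortExact_cokernel i)).1
    (exact_map_and_mono_map F (shortExact_quotientSequence hS i)).2 this
    (inferInstanceAs (Mono (F.map (𝟙 (cokernel i)))))

lemma isZero_rightDerived_one_X₁_of_epi_map (hg : Epi (F.map S.g))
    (h₂ : IsZero ((F.rightDerived 1).obj S.X₂)) : IsZero ((F.rightDerived 1).obj S.X₁) := by
  have := hS.mono_f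
  let i := Injective.ι S.X₂
  rw [isZero_rightDerived_one_iff_epi_map_cokernel F (S.f ≫ i)]
  exact ShortComplex.epi_of_epi_of_epi_of_epi (F.mapShortComplex.map (toQuotientSequence hS i))
    (exact_map_and_mono_map F (shortExact_quotientSequence hS i)).1
    ((isZero_rightDerived_one_iff_epi_map_cokernel F i).1 h₂) hg
    (inferInstanceAs (Epi (F.map (𝟙 (cokernel i)))))

lemma isZero_rightDerived_one_X₃ (h₂ : IsZero ((F.rightDerived 1).obj S.X₂))
    (h₁ : IsZero ((F.rightDerived 2).obj S.X₁)) : IsZero ((F.rightDerived 1).obj S.X₃) := by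
  have := hS.mono_f
  let i := Injective.ι S.X₂
  have : Epi (F.map (cokernel.π (S.f ≫ i)) ≫ F.map (quotientSequence hS i).g) := by
    rw [← F.map_comp, (toQuotientSequence hS i).comm₂₃, Category.comp_id]
    exact (isZero_rightDerived_one_iff_epi_map_cokernel F i).1 h₂
  exact isZero_rightDerived_one_X₁_of_epi_map F (shortExact_quotientSequence hS i)
    (epi_of_epi (F.map (cokernel.π (S.f ≫ i))) _)
    ((isZero_rightDerived_add_two_iff_cokernel F (S.f ≫ i) 0).1 h₁)

lemma isZero_rightDerived_one_X₂ (h₁ : IsZero ((F.rightDerived 1).obj S.X₁))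
    (h₃ : IsZero ((F.rightDerived 1).obj S.X₃)) : IsZero ((F.rightDerived 1).obj S.X₂) := by
  have := hS.mono_f
  let i := Injective.ι S.X₂
  have : Epi (F.map (cokernel.π (S.f ≫ i))) :=
    (isZero_rightDerived_one_iff_epi_map_cokernel F (S.f ≫ i)).1 h₁
  have : Epi (F.map (quotientSequence hS i).g) :=
    epi_map_of_isZero_rightDerived_one F (shortExact_quotientSequence hS i) h₃
  have fac : cokernel.π i = cokernel.π (S.f ≫ i) ≫ (quotientSequence hS i).g := by simp
  rw [isZero_rightDerived_one_iff_epi_map_cokernel F i, fac, F.map_comp]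
  exact epi_comp _ _

omit hS in
lemma isZero_rightDerived_succ_X₂_and_X₃ (n : ℕ) {S : ShortComplex C} (hS : S.ShortExact) :
    (IsZero ((F.rightDerived (n + 1)).obj S.X₁) → IsZero ((F.rightDerived (n + 1)).obj S.X₃) →
      IsZero ((F.rightDerived (n + 1)).obj S.X₂)) ∧
    (IsZero ((F.rightDerived (n + 1)).obj S.X₂) → IsZero ((F.rightDerived (n + 2)).obj S.X₁) →
      IsZero ((F.rightDerived (n + 1)).obj S.X₃)) := by
  induction n generalizing S with
  | zero => exact ⟨isZero_rightDerived_one_X₂ F hS, isZero_rightDerived_one_X₃ F hS⟩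
  | succ n ih =>
    have isZero_X₁ {T : ShortComplex C} (hT : T.ShortExact)
        (h₃ : IsZero ((F.rightDerived (n + 1)).obj T.X₃))
        (h₂ : IsZero ((F.rightDerived (n + 2)).obj T.X₂)) :
        IsZero ((F.rightDerived (n + 2)).obj T.X₁) := by
      have := hT.mono_f
      rw [isZero_rightDerived_add_two_iff_cokernel F (T.f ≫ Injective.ι T.X₂)]
      rw [isZero_rightDerived_add_two_iff_cokernel F (Injective.ι T.X₂)] at h₂
      exact (ih (shortExact_quotientSequence hT _)).1 h₃ h₂
    have := hS.mono_f
    rw [isZero_rightDerived_add_two_iff_cokernel F (Injective.ι S.X₂),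
      isZero_rightDerived_add_two_iff_cokernel F (S.f ≫ Injective.ι S.X₂),
      isZero_rightDerived_add_two_iff_cokernel F (S.f ≫ Injective.ι S.X₂)]
    exact ⟨fun h₁ h₃ => (ih (shortExact_quotientSequence hS _)).2 h₁ h₃,
      isZero_X₁ (shortExact_quotientSequence hS _)⟩

lemma isZero_rightDerived_X₃ (n : ℕ) (h₂ : IsZero ((F.rightDerived n).obj S.X₂))
    (h₁ : IsZero ((F.rightDerived (n + 1)).obj S.X₁)) :
    IsZero ((F.rightDerived n).obj S.X₃) := by
  cases n with
  | zero =>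
    have := epi_map_of_isZero_rightDerived_one F hS h₁
    rw [(F.rightDerivedZeroIsoSelf.app _).isZero_iff] at h₂ ⊢
    exact h₂.of_epi (F.map S.g)
  | succ n => exact (isZero_rightDerived_succ_X₂_and_X₃ F n hS).2 h₂ h₁

omit hS in
lemma isZero_rightDerived_cokernel (n : ℕ) {X Y : C} (f : X ⟶ Y)
    (hY : IsZero ((F.rightDerived n).obj Y)) (hX : IsZero ((F.rightDerived (n + 1)).obj X))
    (hf : IsZero ((F.rightDerived (n + 2)).obj (kernel f))) :
    IsZero ((F.rightDerived n).obj (cokernel f)) := by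
  have hcoim : IsZero ((F.rightDerived (n + 1)).obj (Abelian.coimage f)) :=
    isZero_rightDerived_X₃ F (shortExact_cokernel (kernel.ι f)) (n + 1) hX hf
  let e : cokernel (Abelian.factorThruCoimage f) ≅ cokernel f :=
    (cokernelEpiComp (Abelian.coimage.π f) _).symm ≪≫ cokernelIsoOfEq (Abelian.coimage.fac f)
  exact (isZero_rightDerived_X₃ F (shortExact_cokernel (Abelian.factorThruCoimage f)) n hY
    hcoim).of_iso ((F.rightDerived n).mapIso e.symm)

end RightDerivedVanishing

section ExactFunctors

/-- Right derived functors commute with postcomposition by an exact functor. -/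
noncomputable def rightDerivedCompObjIso [HasInjectiveResolutions C] (F : C ⥤ D) [F.Additive]
    (G : D ⥤ E) [G.Additive] [G.PreservesHomology] (n : ℕ) (X : C) :
    ((F ⋙ G).rightDerived n).obj X ≅ G.obj ((F.rightDerived n).obj X) :=
  (injectiveResolution X).isoRightDerivedObj (F ⋙ G) n ≪≫
    ShortComplex.mapHomologyIso (((F.mapHomologicalComplex _).obj
      (injectiveResolution X).cocomplex).sc n) G ≪≫
    G.mapIso ((injectiveResolution X).isoRightDerivedObj F n).symm

/-- Left derived functors commute with postcomposition by an exact functor. -/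
noncomputable def leftDerivedCompObjIso [HasProjectiveResolutions C] (F : C ⥤ D) [F.Additive]
    (G : D ⥤ E) [G.Additive] [G.PreservesHomology] (n : ℕ) (X : C) :
    ((F ⋙ G).leftDerived n).obj X ≅ G.obj ((F.leftDerived n).obj X) :=
  (projectiveResolution X).isoLeftDerivedObj (F ⋙ G) n ≪≫
    ShortComplex.mapHomologyIso (((F.mapHomologicalComplex _).obj
      (projectiveResolution X).complex).sc n) G ≪≫
    G.mapIso ((projectiveResolution X).isoLeftDerivedObj F n).symm

/-- Isomorphic functors have isomorphic right derived functors. -/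
noncomputable def rightDerivedObjCongr [HasInjectiveResolutions C] {F G : C ⥤ D} [F.Additive]
    [G.Additive] (e : F ≅ G) (n : ℕ) (X : C) :
    (F.rightDerived n).obj X ≅ (G.rightDerived n).obj X where
  hom := (NatTrans.rightDerived e.hom n).app X
  inv := (NatTrans.rightDerived e.inv n).app X
  hom_inv_id := by
    rw [← NatTrans.comp_app, ← NatTrans.rightDerived_comp, e.hom_inv_id, NatTrans.rightDerived_id,
      NatTrans.id_app]
  inv_hom_id := by
    rw [← NatTrans.comp_app, ← NatTrans.rightDerived_comp, e.inv_hom_id, NatTrans.rightDerived_id,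
      NatTrans.id_app]

/-- An exact functor preserving injective objects maps injective resolutions to injective
resolutions. -/
noncomputable def mapInjectiveResolution (G : C ⥤ D) [G.Additive] [G.PreservesHomology]
    [G.PreservesInjectiveObjects] {X : C} (J : InjectiveResolution X) :
    InjectiveResolution (G.obj X) where
  cocomplex := (G.mapHomologicalComplex _).obj J.cocomplex
  injective _ := inferInstanceAs (Injective (G.obj _))
  ι := (HomologicalComplex.singleMapHomologicalComplex _ _ _).inv.app _ ≫
    (G.mapHomologicalComplex _).map J.ι
  quasiIso := inferInstance

/-- Right derived functors commute with precomposition by an exact functor preserving injective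
objects. -/
noncomputable def rightDerivedObjIsoPrecomp [HasInjectiveResolutions C] [HasInjectiveResolutions D]
    (G : C ⥤ D) [G.Additive] [G.PreservesHomology] [G.PreservesInjectiveObjects] (F : D ⥤ E)
    [F.Additive] (n : ℕ) (X : C) :
    (F.rightDerived n).obj (G.obj X) ≅ ((G ⋙ F).rightDerived n).obj X :=
  (mapInjectiveResolution G (injectiveResolution X)).isoRightDerivedObj F n ≪≫
    ((injectiveResolution X).isoRightDerivedObj (G ⋙ F) n).symm

end ExactFunctors

end DerivedFunctors

namespace FI

/-- The function underlying a morphism of `FI`. -/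
def fn {S T : FI.{u}} (f : S ⟶ T) : S.carrier → T.carrier :=
  (show S.carrier ↪ T.carrier from f)

/-- The morphism of `FI` given by an injective function. -/
def ofInjective {S T : FI.{u}} (f : S.carrier → T.carrier) (hf : Function.Injective f) : S ⟶ T :=
  (⟨f, hf⟩ : S.carrier ↪ T.carrier)

lemma fn_injective {S T : FI.{u}} (f : S ⟶ T) : Function.Injective (fn f) :=
  (show S.carrier ↪ T.carrier from f).injective

lemma hom_ext {S T : FI.{u}} {f g : S ⟶ T} (h : ∀ x, fn f x = fn g x) : f = g :=
  Function.Embedding.ext h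

lemma card_addPoint (S : FI.{u}) : Nat.card (addPoint.obj S).carrier = Nat.card S.carrier + 1 :=
  Finite.card_option

lemma card_le_of_hom {S T : FI.{u}} (f : S ⟶ T) : Nat.card S.carrier ≤ Nat.card T.carrier :=
  Nat.card_le_card_of_injective _ (fn_injective f)

lemma exists_hom_le_card (S : FI.{u}) (n : ℕ) :
    ∃ (T : FI.{u}) (_ : S ⟶ T), n ≤ Nat.card T.carrier := by
  refine ⟨⟨S.carrier ⊕ ULift.{u} (Fin n), inferInstance⟩,
    ofInjective Sum.inl Sum.inl_injective, ?_⟩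
  change n ≤ Nat.card (S.carrier ⊕ ULift.{u} (Fin n))
  simp [Nat.card_sum]

/-- The injection `(S ∖ {s}) ⊔ {*} ⟶ S` sending `*` to `s`. -/
def fillPoint {S : FI.{u}} (s : S.carrier) : addPoint.obj (sub {j | j ≠ s}) ⟶ S :=
  ofInjective (fun j => j.elim s Subtype.val) (by
    rintro (_ | x) (_ | y) h
    · rfl
    · exact absurd h.symm y.2
    · exact absurd h x.2
    · exact congr_arg some (Subtype.ext h))

/-- The restriction of an injection from `T ⊔ {*}` to the complement of the image of `*`. -/
def dropPoint {S T : FI.{u}} (f : addPoint.obj T ⟶ S) : T ⟶ sub {j | j ≠ fn f none} :=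
  ofInjective (fun t => ⟨fn f (some t), fun h => Option.some_ne_none t (fn_injective f h)⟩)
    (fun _ _ h => Option.some_injective _ (fn_injective f (congr_arg Subtype.val h)))

lemma addPoint_map_dropPoint_comp_fillPoint {S T : FI.{u}} (f : addPoint.obj T ⟶ S) :
    addPoint.map (dropPoint f) ≫ fillPoint (fn f none) = f := by
  apply hom_ext
  rintro (_ | x) <;> rfl

lemma exists_addPoint_map_eq_comp {S T : FI.{u}} (f : addPoint.obj S ⟶ T) :
    ∃ (g : S ⟶ T) (p : T ⟶ addPoint.obj T), addPoint.map g = f ≫ p := by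
  classical
  have collapse_injective (t₀ : T.carrier) :
      Function.Injective fun t => if t = t₀ then none else some t := by
    intro a b h
    grind
  refine ⟨inclPoint.app S ≫ f, ofInjective _ (collapse_injective (fn f none)), hom_ext ?_⟩
  rintro (_ | s)
  · exact (if_pos rfl).symm
  · exact (if_neg fun h => Option.some_ne_none s (fn_injective f h)).symm

end FI

namespace FIMod

variable {R : Type} [CommRing R]

section Pointwise

variable {V W : FIMod.{u} R} {S T U : FI.{u}}

variable (R) in
/-- Evaluation of `FI`-modules at a finite set. -/
abbrev eval (S : FI.{u}) : FIMod.{u} R ⥤ ModuleCat.{u} R :=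
  (evaluation _ _).obj S

lemma mono_iff_injective (f : V ⟶ W) : Mono f ↔ ∀ S, Function.Injective (f.app S).hom := by
  rw [NatTrans.mono_iff_mono_app]
  exact forall_congr' fun S => ModuleCat.mono_iff_injective _

lemma epi_iff_surjective (f : V ⟶ W) : Epi f ↔ ∀ S, Function.Surjective (f.app S).hom := by
  rw [NatTrans.epi_iff_epi_app]
  exact forall_congr' fun S => ModuleCat.epi_iff_surjective _

lemma exact_iff {A : ShortComplex (FIMod.{u} R)} :
    A.Exact ↔ ∀ S, Function.Exact (A.f.app S).hom (A.g.app S).hom := by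
  rw [ShortComplex.exact_iff_isZero_homology, Functor.isZero_iff]
  refine forall_congr' fun S => ?_
  rw [show A.homology.obj S = (eval R S).obj A.homology from rfl,
    ← (A.mapHomologyIso (eval R S)).isZero_iff, ← ShortComplex.exact_iff_isZero_homology,
    ShortComplex.ShortExact.moduleCat_exact_iff_function_exact]
  rfl

instance : PreservesFiniteLimits (shift.{u} R) := ⟨fun _ => inferInstance⟩

instance : PreservesFiniteColimits (shift.{u} R) := ⟨fun _ => inferInstance⟩

lemma isZero_obj_iff : IsZero (V.obj S) ↔ ∀ x : V.obj S, x = 0 := by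
  rw [ModuleCat.isZero_iff_subsingleton]
  exact subsingleton_iff_forall_eq 0

lemma map_comp_apply (V : FIMod.{u} R) (f : S ⟶ T) (g : T ⟶ U) (x : V.obj S) :
    (V.map (f ≫ g)).hom x = (V.map g).hom ((V.map f).hom x) := by
  rw [V.map_comp]
  rfl

lemma app_map_apply (φ : V ⟶ W) (f : S ⟶ T) (x : V.obj S) :
    (φ.app T).hom ((V.map f).hom x) = (W.map f).hom ((φ.app S).hom x) :=
  congr_arg (fun t => t.hom x) (φ.naturality f)

end Pointwise

/-! ### Coinduced modules -/

section Coinduced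

variable {A : Type u} (s : A → FI.{u}) (E : A → ModuleCat.{u} R)

/-- The coinduced `FI`-module `T ↦ ∏ₐ Map(Hom(T, s a), E a)`. -/
def coind : FIMod.{u} R where
  obj T := ModuleCat.of R (∀ a : A, (T ⟶ s a) → E a)
  map f := ModuleCat.ofHom
    { toFun := fun φ a h => φ a (f ≫ h)
      map_add' := fun _ _ => rfl
      map_smul' := fun _ _ => rfl }
  map_id T := by
    ext φ a h
    exact congr_arg (φ a) (Category.id_comp h)
  map_comp f g := by
    ext φ a h
    exact congr_arg (φ a) (Category.assoc f g h)

variable {s E}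

/-- The morphism to a coinduced module determined by its components at the identities of the
`s a`. -/
def toCoind {V : FIMod.{u} R} (ι : ∀ a, V.obj (s a) ⟶ E a) : V ⟶ coind s E where
  app T := ModuleCat.ofHom (LinearMap.pi fun a => LinearMap.pi fun h => (V.map h ≫ ι a).hom)
  naturality T U f := by
    ext x
    funext a h
    exact congr_arg (ι a).hom (map_comp_apply V f h x).symm

/-- The component at the identity of `s a` of a morphism to a coinduced module. -/
def coindComponent {V : FIMod.{u} R} (φ : V ⟶ coind s E) (a : A) : V.obj (s a) ⟶ E a :=
  φ.app (s a) ≫ ModuleCat.ofHom (LinearMap.proj (𝟙 (s a)) ∘ₗ LinearMap.proj a)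

lemma toCoind_coindComponent {V : FIMod.{u} R} (φ : V ⟶ coind s E) :
    toCoind (coindComponent φ) = φ := by
  ext T x
  funext a h
  change ((φ.app (s a)).hom ((V.map h).hom x)) a (𝟙 _) = ((φ.app T).hom x) a h
  rw [app_map_apply]
  exact congr_arg (((φ.app T).hom x) a) (Category.comp_id h)

lemma comp_toCoind {V W : FIMod.{u} R} (g : V ⟶ W) (ι : ∀ a, W.obj (s a) ⟶ E a) :
    g ≫ toCoind ι = toCoind fun a => g.app (s a) ≫ ι a := by
  ext T x
  funext a h
  exact congr_arg (ι a).hom (app_map_apply g h x).symm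

lemma injective_coind (hE : ∀ a, Injective (E a)) : Injective (coind s E) where
  factors φ g _ :=
    ⟨toCoind fun a => Injective.factorThru (coindComponent φ a) (g.app (s a)), by
      simp only [comp_toCoind, Injective.comp_factorThru, toCoind_coindComponent]⟩

variable (s E) in
/-- An injection `T ⊔ {*} ⟶ s a` is a point `i` of `s a` and an injection `T ⟶ s a ∖ {i}`. -/
def shiftCoindIso : (shift R).obj (coind s E) ≅
    coind (A := Σ a, (s a).carrier) (fun x => FI.sub {j | j ≠ x.2}) (fun x => E x.1) :=
  NatIso.ofComponents (fun T => LinearEquiv.toModuleIso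
    { toFun := fun φ x h => φ x.1 (FI.addPoint.map h ≫ FI.fillPoint x.2)
      invFun := fun ψ a h => ψ ⟨a, FI.fn h none⟩ (FI.dropPoint h)
      map_add' := fun _ _ => rfl
      map_smul' := fun _ _ => rfl
      left_inv := fun φ => by
        funext a h
        exact congr_arg (φ a) (FI.addPoint_map_dropPoint_comp_fillPoint h)
      right_inv := fun _ => rfl }) fun f => by
    ext φ
    funext x h
    exact congr_arg (φ x.1) (by rw [FI.addPoint.map_comp, Category.assoc])

lemma injective_shift_coind (hE : ∀ a, Injective (E a)) : Injective ((shift R).obj (coind s E)) :=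
  Injective.of_iso (shiftCoindIso s E).symm (injective_coind fun x => hE x.1)

end Coinduced

/-! ### Injective envelopes, shifts and vanishing from some degree on -/

section Envelope

/-- A coinduced injective module containing `V`, built from the sets where `V` does not vanish. -/
noncomputable def envelope (V : FIMod.{u} R) : FIMod.{u} R :=
  coind (A := {a // ¬ IsZero (V.obj (std.{u}.obj a))}) (fun a => std.obj a.1)
    (fun a => Injective.under (V.obj (std.obj a.1)))

/-- The inclusion of an `FI`-module in its envelope. -/
noncomputable def toEnvelope (V : FIMod.{u} R) : V ⟶ envelope V :=
  toCoind fun a => Injective.ι (V.obj (std.obj a.1))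

instance mono_toEnvelope (V : FIMod.{u} R) : Mono (toEnvelope V) := by
  refine (mono_iff_injective _).2 fun S => (injective_iff_map_eq_zero _).2 fun x hx => ?_
  obtain ⟨a, ⟨e⟩⟩ := exists_iso_std S
  have map_inv_eq_zero : (V.map e.inv).hom x = 0 := by
    by_cases ha : IsZero (V.obj (std.obj a))
    · exact isZero_obj_iff.1 ha _
    · exact (ModuleCat.mono_iff_injective (Injective.ι (V.obj (std.obj a)))).1 inferInstance
        ((congr_fun (congr_fun hx ⟨a, ha⟩) e.inv).trans (map_zero _).symm)
  have : Mono (V.map e.inv) := inferInstance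
  exact (ModuleCat.mono_iff_injective _).1 this (map_inv_eq_zero.trans (map_zero _).symm)

instance injective_envelope (V : FIMod.{u} R) : Injective (envelope V) :=
  injective_coind fun _ => inferInstance

instance preservesInjectiveObjects_shift : (shift.{u} R).PreservesInjectiveObjects where
  injective_obj {I} hI := by
    let r : envelope I ⟶ I := Injective.factorThru (𝟙 I) (toEnvelope I)
    have hr : toEnvelope I ≫ r = 𝟙 I := Injective.comp_factorThru _ _
    have : Injective ((shift R).obj (envelope I)) := injective_shift_coind fun _ => inferInstance
    refine ⟨fun φ g _ =>
      ⟨Injective.factorThru (φ ≫ (shift R).map (toEnvelope I)) g ≫ (shift R).map r, ?_⟩⟩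
    rw [Injective.comp_factorThru_assoc, Category.assoc, ← Functor.map_comp, hr,
      CategoryTheory.Functor.map_id, Category.comp_id]

/-- `W` vanishes on the sets with at least `n` elements. -/
def VanishesFrom (n : ℕ) (W : FIMod.{u} R) : Prop :=
  ∀ S : FI.{u}, n ≤ Nat.card S.carrier → IsZero (W.obj S)

namespace VanishesFrom

variable {n : ℕ} {V W : FIMod.{u} R}

lemma envelope (hV : VanishesFrom n V) : VanishesFrom n (envelope V) := by
  refine fun S hS => isZero_obj_iff.2 fun x => ?_
  funext a f
  exact absurd (hV _ (hS.trans (FI.card_le_of_hom f))) a.2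

lemma of_epi (f : V ⟶ W) [Epi f] (hV : VanishesFrom n V) : VanishesFrom n W :=
  fun S hS => (hV S hS).of_epi (f.app S)

lemma of_mono (f : V ⟶ W) [Mono f] (hW : VanishesFrom n W) : VanishesFrom n V :=
  fun S hS => (hW S hS).of_mono (f.app S)

lemma torsionAt_eq_top (hW : VanishesFrom n W) (S : FI.{u}) : torsionAt W S = ⊤ := by
  refine eq_top_iff.2 fun x _ => ?_
  obtain ⟨T, f, hT⟩ := FI.exists_hom_le_card S n
  exact ⟨T, f, isZero_obj_iff.1 (hW T hT) _⟩

end VanishesFrom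

end Envelope

/-! ### Vanishing of local cohomology -/

section LocalCohomology

instance (S : FI.{u}) : PreservesFiniteLimits (torsion R ⋙ eval R S) := by
  refine ((torsion R ⋙ eval R S).preservesFiniteLimits_tfae.out 0 3 :).1 fun A hA => ?_
  have hinj := fun T => (mono_iff_injective A.f).1 hA.mono_f T
  constructor
  · rw [ShortComplex.ShortExact.moduleCat_exact_iff_function_exact]
    rintro ⟨y, T, α, hy⟩
    constructor
    · intro h
      obtain ⟨x, rfl⟩ := (exact_iff.1 hA.exact S y).1 (congr_arg Subtype.val h)
      refine ⟨⟨x, T, α, hinj T ?_⟩, rfl⟩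
      rw [app_map_apply, hy, map_zero]
    · rintro ⟨x, hx⟩
      exact Subtype.ext ((exact_iff.1 hA.exact S y).2 ⟨x.1, congr_arg Subtype.val hx⟩)
  · exact (ModuleCat.mono_iff_injective _).2 fun x y h =>
      Subtype.ext (hinj S (congr_arg Subtype.val h))

lemma isZero_localCohomology_obj_iff {j : ℕ} {V : FIMod.{u} R} {S : FI.{u}} :
    IsZero (((localCohomology R j).obj V).obj S) ↔
      IsZero (((torsion R ⋙ eval R S).rightDerived j).obj V) :=
  (rightDerivedCompObjIso (torsion R) (eval R S) j V).isZero_iff.symm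

lemma isZero_localCohomology_zero_obj_iff {V : FIMod.{u} R} {S : FI.{u}} :
    IsZero (((localCohomology R 0).obj V).obj S) ↔ torsionAt V S = ⊥ := by
  rw [isZero_localCohomology_obj_iff,
    ((torsion R ⋙ eval R S).rightDerivedZeroIsoSelf.app V).isZero_iff,
    ← Submodule.subsingleton_iff_eq_bot]
  exact ModuleCat.isZero_iff_subsingleton

lemma torsionAt_shift (V : FIMod.{u} R) (S : FI.{u}) :
    torsionAt ((shift R).obj V) S = torsionAt V (FI.addPoint.obj S) := by
  ext x
  constructor
  · rintro ⟨T, f, hx⟩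
    exact ⟨_, FI.addPoint.map f, hx⟩
  · rintro ⟨T, f, hx⟩
    obtain ⟨g, p, hg⟩ := FI.exists_addPoint_map_eq_comp f
    refine ⟨T, g, ?_⟩
    change (V.map (FI.addPoint.map g)).hom x = 0
    rw [hg, map_comp_apply, hx, map_zero]

variable (R) in
/-- Torsion commutes with the shift. -/
def shiftCompTorsionIso : shift.{u} R ⋙ torsion R ≅ torsion R ⋙ shift R :=
  NatIso.ofComponents fun V => NatIso.ofComponents fun S =>
    (LinearEquiv.ofEq _ _ (torsionAt_shift V S)).toModuleIso

/-- Local cohomology commutes with the shift. -/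
noncomputable def localCohomologyShiftIso (j : ℕ) (V : FIMod.{u} R) :
    (localCohomology R j).obj ((shift R).obj V) ≅ (shift R).obj ((localCohomology R j).obj V) :=
  rightDerivedObjIsoPrecomp (shift R) (torsion R) j V ≪≫
    rightDerivedObjCongr (shiftCompTorsionIso R) j V ≪≫
    rightDerivedCompObjIso (torsion R) (shift R) j V

lemma VanishesFrom.isZero_localCohomology_succ {n : ℕ} {W : FIMod.{u} R} (hW : VanishesFrom n W)
    (j : ℕ) (S : FI.{u}) : IsZero (((localCohomology R (j + 1)).obj W).obj S) := by
  rw [isZero_localCohomology_obj_iff]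
  induction j generalizing W with
  | zero =>
    rw [isZero_rightDerived_one_iff_epi_map_cokernel _ (toEnvelope W),
      ModuleCat.epi_iff_surjective]
    rintro ⟨z, hz⟩
    obtain ⟨y, rfl⟩ := (epi_iff_surjective (cokernel.π (toEnvelope W))).1 inferInstance S z
    exact ⟨⟨y, hW.envelope.torsionAt_eq_top S ▸ Submodule.mem_top⟩, rfl⟩
  | succ j ih =>
    rw [isZero_rightDerived_add_two_iff_cokernel _ (toEnvelope W)]
    exact ih (hW.envelope.of_epi (cokernel.π (toEnvelope W)))

/-- The natural map from an `FI`-module to its shift. -/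
def shiftι (V : FIMod.{u} R) : V ⟶ (shift R).obj V := (toShift R).app V

/-- The kernel of the natural map from an `FI`-module to its shift. -/
noncomputable abbrev kerShift (V : FIMod.{u} R) : FIMod.{u} R := kernel (shiftι V)

lemma isZero_localCohomology_derivative {n : ℕ} {V : FIMod.{u} R}
    (hV : VanishesFrom n (kerShift V)) {j : ℕ} {S : FI.{u}}
    (hj : IsZero (((localCohomology R j).obj V).obj (FI.addPoint.obj S)))
    (hj' : IsZero (((localCohomology R (j + 1)).obj V).obj S)) :
    IsZero (((localCohomology R j).obj ((derivative R).obj V)).obj S) := by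
  have hshift : IsZero (((localCohomology R j).obj ((shift R).obj V)).obj S) :=
    hj.of_iso ((localCohomologyShiftIso j V).app S)
  have hker := hV.isZero_localCohomology_succ (j + 1) S
  rw [isZero_localCohomology_obj_iff] at hshift hker hj' ⊢
  exact isZero_rightDerived_cokernel (torsion R ⋙ eval R S) j (shiftι V) hshift hj' hker

end LocalCohomology

end FIMod

/-! ### Generation in finite degrees -/

namespace FI

lemma exists_comp_eq {S T U : FI.{u}} {f : S ⟶ T} {g : U ⟶ T}
    (h : Set.range (fn f) ⊆ Set.range (fn g)) : ∃ k : S ⟶ U, k ≫ g = f := by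
  choose k hk using fun x => h (Set.mem_range_self x)
  exact ⟨ofInjective k fun x y hxy =>
    fn_injective f ((hk x).symm.trans ((congr_arg (fn g) hxy).trans (hk y))), hom_ext hk⟩

lemma range_incl {S : FI.{u}} (A : Set S.carrier) : Set.range (fn (incl A)) = A :=
  Subtype.range_coe

lemma card_sub_ne_add_one {S : FI.{u}} (s : S.carrier) :
    Nat.card (sub {j | j ≠ s}).carrier + 1 = Nat.card S.carrier := by
  classical
  rw [← card_addPoint]
  exact Nat.card_congr (Equiv.optionSubtypeNe s)

lemma nonempty_iso_of_card_eq {S T : FI.{u}} (h : Nat.card S.carrier = Nat.card T.carrier) :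
    Nonempty (S ≅ T) :=
  let e := (Finite.equivFinOfCardEq h).trans (Finite.equivFin _).symm
  ⟨⟨ofInjective e e.injective, ofInjective e.symm e.symm.injective,
    hom_ext e.symm_apply_apply, hom_ext e.apply_symm_apply⟩⟩

lemma exists_addPoint_iso {S : FI.{u}} {n : ℕ} (h : Nat.card S.carrier = n + 1) :
    ∃ T : FI.{u}, Nat.card T.carrier = n ∧ Nonempty (addPoint.obj T ≅ S) := by
  have : 0 < Nat.card S.carrier := h ▸ n.succ_pos
  obtain ⟨s⟩ := (Nat.card_pos_iff.1 this).1
  have hs := card_sub_ne_add_one s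
  exact ⟨sub {j | j ≠ s}, by omega, nonempty_iso_of_card_eq ((card_addPoint _).trans hs)⟩

end FI

namespace FIMod

variable {R : Type} [CommRing R]

section Generation

variable {n m : ℕ} {V W : FIMod.{u} R} {S T U : FI.{u}}

lemma range_map_le_range_map (V : FIMod.{u} R) {f : S ⟶ T} {g : U ⟶ T}
    (h : Set.range (FI.fn f) ⊆ Set.range (FI.fn g)) :
    LinearMap.range (V.map f).hom ≤ LinearMap.range (V.map g).hom := by
  obtain ⟨k, rfl⟩ := FI.exists_comp_eq h
  rw [V.map_comp]
  exact LinearMap.range_comp_le_range _ _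

lemma fromProper_eq_iSup (V : FIMod.{u} R) (S : FI.{u}) :
    fromProper V S = ⨆ s : S.carrier, LinearMap.range (V.map (FI.incl {j | j ≠ s})).hom := by
  refine le_antisymm (iSup₂_le fun A hA => ?_) (iSup_le fun s => ?_)
  · obtain ⟨s, hs⟩ := (Set.ne_univ_iff_exists_notMem A).1 hA
    refine le_iSup_of_le s (range_map_le_range_map V ?_)
    rw [FI.range_incl, FI.range_incl]
    exact fun j hj h => hs (h ▸ hj)
  · exact le_iSup₂ (f := fun (A : Set S.carrier) (_ : A ≠ Set.univ) =>
      LinearMap.range (V.map (FI.incl A)).hom) {j | j ≠ s}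
      ((Set.ne_univ_iff_exists_notMem _).2 ⟨s, fun h => h rfl⟩)

lemma range_map_le_fromProper (V : FIMod.{u} R) {f : S ⟶ T} {t : T.carrier}
    (ht : t ∉ Set.range (FI.fn f)) : LinearMap.range (V.map f).hom ≤ fromProper V T := by
  rw [fromProper_eq_iSup]
  refine le_iSup_of_le t (range_map_le_range_map V ?_)
  rw [FI.range_incl]
  exact fun j hj h => ht (h ▸ hj)

lemma map_range_map (φ : V ⟶ W) (f : S ⟶ T) :
    (LinearMap.range (V.map f).hom).map (φ.app T).hom =
      (LinearMap.range (φ.app S).hom).map (W.map f).hom := by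
  rw [← LinearMap.range_comp, ← LinearMap.range_comp, ← ModuleCat.hom_comp, ← ModuleCat.hom_comp,
    φ.naturality]

lemma map_fromProper (φ : V ⟶ W) [Epi φ] (S : FI.{u}) :
    (fromProper V S).map (φ.app S).hom = fromProper W S := by
  simp only [fromProper_eq_iSup, Submodule.map_iSup, map_range_map,
    LinearMap.range_eq_top.2 ((epi_iff_surjective φ).1 inferInstance _), Submodule.map_top]

lemma fromProper_addPoint (V : FIMod.{u} R) (S : FI.{u}) :
    fromProper V (FI.addPoint.obj S) =
      fromProper ((shift R).obj V) S ⊔ LinearMap.range (V.map (FI.inclPoint.app S)).hom := by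
  apply le_antisymm
  · rw [fromProper_eq_iSup]
    refine iSup_le ?_
    rintro (_ | s)
    · refine le_sup_of_le_right (range_map_le_range_map V ?_)
      rw [FI.range_incl]
      rintro (_ | t) ht
      · exact absurd rfl ht
      · exact ⟨t, rfl⟩
    · rw [fromProper_eq_iSup]
      refine le_sup_of_le_left (le_iSup_of_le s (range_map_le_range_map V
        (g := FI.addPoint.map (FI.incl {j | j ≠ s})) ?_))
      rw [FI.range_incl]
      rintro (_ | t) ht
      · exact ⟨none, rfl⟩
      · exact ⟨some ⟨t, fun h => ht (congr_arg some h)⟩, rfl⟩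
  · refine sup_le ?_ (range_map_le_fromProper V (t := none) ?_)
    · rw [fromProper_eq_iSup]
      refine iSup_le fun s => range_map_le_fromProper V
        (f := FI.addPoint.map (FI.incl {j | j ≠ s})) (t := some s) ?_
      rintro ⟨_ | t, ht⟩
      · cases ht
      · exact t.2 (Option.some_injective _ ht)
    · rintro ⟨t, ht⟩
      cases ht

/-- `V` is generated by its elements on the sets with less than `n` elements. -/
def GeneratedBelow (n : ℕ) (V : FIMod.{u} R) : Prop :=
  ∀ S : FI.{u}, n ≤ Nat.card S.carrier → fromProper V S = ⊤

lemma fromProper_eq_top_of_epi (φ : V ⟶ W) [Epi φ] (h : fromProper V S = ⊤) :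
    fromProper W S = ⊤ := by
  rw [← map_fromProper φ, h, Submodule.map_top]
  exact LinearMap.range_eq_top.2 ((epi_iff_surjective φ).1 inferInstance S)

lemma fromProper_eq_top_of_exact {A : ShortComplex (FIMod.{u} R)} (hA : A.Exact) [Epi A.g]
    (h₁ : fromProper A.X₁ S = ⊤) (h₃ : fromProper A.X₃ S = ⊤) : fromProper A.X₂ S = ⊤ := by
  rw [← map_fromProper A.g, LinearMap.map_eq_top_iff
    (LinearMap.range_eq_top.2 ((epi_iff_surjective A.g).1 inferInstance S))] at h₃
  rw [← h₃, left_eq_sup, (exact_iff.1 hA S).linearMap_ker_eq, ← Submodule.map_top, ← h₁,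
    Submodule.map_le_iff_le_comap]
  exact fromProper_le_comap_app A.f S

lemma fromProper_eq_top_of_iso (V : FIMod.{u} R) (e : S ≅ T) (h : fromProper V S = ⊤) :
    fromProper V T = ⊤ := by
  refine eq_top_iff.2 fun x _ => ?_
  have hx := fromProper_le_comap V e.hom (h ▸ Submodule.mem_top : (V.map e.inv).hom x ∈ _)
  rwa [Submodule.mem_comap, ← map_comp_apply, e.inv_hom_id, V.map_id] at hx

lemma eq_zero_of_generatedBelow_zero (hV : GeneratedBelow 0 V) (S : FI.{u}) (x : V.obj S) :
    x = 0 := by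
  induction hn : Nat.card S.carrier generalizing S with
  | zero =>
    have := (Finite.card_eq_zero_iff).1 hn
    have := hV S (Nat.zero_le _)
    rw [fromProper_eq_iSup, iSup_of_empty] at this
    exact (Submodule.mem_bot R).1 (this ▸ Submodule.mem_top)
  | succ n ih =>
    have : fromProper V S ≤ ⊥ := by
      rw [fromProper_eq_iSup]
      refine iSup_le fun s => ?_
      rintro _ ⟨y, rfl⟩
      have := FI.card_sub_ne_add_one s
      rw [ih _ y (by omega), map_zero]
      exact zero_mem _
    rw [hV S (Nat.zero_le _)] at this
    exact (Submodule.mem_bot R).1 (this Submodule.mem_top)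

namespace GeneratedBelow

lemma mono (hV : GeneratedBelow n V) (h : n ≤ m) : GeneratedBelow m V :=
  fun S hS => hV S (h.trans hS)

lemma of_epi (φ : V ⟶ W) [Epi φ] (hV : GeneratedBelow n V) : GeneratedBelow n W :=
  fun S hS => fromProper_eq_top_of_epi φ (hV S hS)

lemma X₁_of_shortExact {A : ShortComplex (FIMod.{u} R)} (hA : A.ShortExact)
    (h₂ : GeneratedBelow n A.X₂) (h₃ : VanishesFrom m A.X₃) :
    GeneratedBelow (max n (m + 1)) A.X₁ := by
  refine fun S hS => ?_
  have hle : fromProper A.X₂ S ≤ (fromProper A.X₁ S).map (A.f.app S).hom := by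
    simp only [fromProper_eq_iSup, Submodule.map_iSup, map_range_map]
    refine iSup_mono fun s => ?_
    have hs : m ≤ Nat.card (FI.sub {j | j ≠ s}).carrier := by
      have := FI.card_sub_ne_add_one s
      omega
    have hf : LinearMap.range (A.f.app (FI.sub {j | j ≠ s})).hom = ⊤ := by
      rw [← (exact_iff.1 hA.exact _).linearMap_ker_eq, LinearMap.ker_eq_top]
      exact LinearMap.ext fun x => isZero_obj_iff.1 (h₃ _ hs) _
    rw [hf, Submodule.map_top]
  rw [h₂ S (by omega)] at hle
  refine eq_top_iff.2 fun x _ => ?_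
  obtain ⟨y, hy, hyx⟩ := hle (Submodule.mem_top (x := (A.f.app S).hom x))
  exact (mono_iff_injective A.f).1 hA.mono_f S hyx ▸ hy

end GeneratedBelow

/-- `V` is generated by its elements on the sets with less than `n` elements, for some `n`. -/
def GeneratedInFiniteDegrees (V : FIMod.{u} R) : Prop := ∃ n, GeneratedBelow n V

namespace GeneratedInFiniteDegrees

lemma of_epi (φ : V ⟶ W) [Epi φ] :
    GeneratedInFiniteDegrees V → GeneratedInFiniteDegrees W
  | ⟨n, hn⟩ => ⟨n, hn.of_epi φ⟩

lemma of_exact {A : ShortComplex (FIMod.{u} R)} (hA : A.Exact) [Epi A.g] :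
    GeneratedInFiniteDegrees A.X₁ → GeneratedInFiniteDegrees A.X₃ → GeneratedInFiniteDegrees A.X₂
  | ⟨n, hn⟩, ⟨m, hm⟩ => ⟨max n m, fun S hS =>
    fromProper_eq_top_of_exact hA (hn S (by omega)) (hm S (by omega))⟩

end GeneratedInFiniteDegrees

end Generation

end FIMod

namespace FIMod

variable {R : Type} [CommRing R]

section Derivative

variable {n : ℕ} {V W : FIMod.{u} R} {S : FI.{u}}

/-- The projection from the shift of an `FI`-module to its derivative. -/
noncomputable def shiftπ (V : FIMod.{u} R) : (shift R).obj V ⟶ (derivative R).obj V :=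
  cokernel.π ((toShift R).app V)

instance (V : FIMod.{u} R) : Epi (shiftπ V) :=
  inferInstanceAs (Epi (cokernel.π ((toShift R).app V)))

lemma shiftι_shiftπ (V : FIMod.{u} R) : shiftι V ≫ shiftπ V = 0 :=
  cokernel.condition ((toShift R).app V)

lemma exact_shiftι_shiftπ (V : FIMod.{u} R) : (ShortComplex.mk _ _ (shiftι_shiftπ V)).Exact :=
  ShortComplex.exact_cokernel ((toShift R).app V)

lemma shiftι_naturality (φ : V ⟶ W) : shiftι V ≫ (shift R).map φ = φ ≫ shiftι W :=
  ((toShift R).naturality φ).symm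

lemma shiftπ_naturality (φ : V ⟶ W) :
    shiftπ V ≫ (derivative R).map φ = (shift R).map φ ≫ shiftπ W :=
  cokernel.π_desc _ _ _

lemma fromProper_derivative_eq_top_iff :
    fromProper ((derivative R).obj V) S = ⊤ ↔ fromProper V (FI.addPoint.obj S) = ⊤ := by
  have hπ := LinearMap.range_eq_top.2 ((epi_iff_surjective (shiftπ V)).1 inferInstance S)
  have hker : LinearMap.ker ((shiftπ V).app S).hom =
      LinearMap.range (V.map (FI.inclPoint.app S)).hom :=
    (exact_iff.1 (exact_shiftι_shiftπ V) S).linearMap_ker_eq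
  rw [← map_fromProper (shiftπ V), LinearMap.map_eq_top_iff hπ, hker]
  exact (fromProper_addPoint V S).symm.congr_left

lemma generatedBelow_derivative_iff :
    GeneratedBelow n ((derivative R).obj V) ↔ GeneratedBelow (n + 1) V := by
  refine ⟨fun h S hS => ?_, fun h S hS => fromProper_derivative_eq_top_iff.2 (h _ ?_)⟩
  · obtain ⟨m, hm⟩ : ∃ m, Nat.card S.carrier = m + 1 := Nat.exists_eq_add_one.2 (by omega)
    obtain ⟨T, hT, ⟨e⟩⟩ := FI.exists_addPoint_iso hm
    exact fromProper_eq_top_of_iso V e (fromProper_derivative_eq_top_iff.1 (h T (by omega)))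
  · rw [FI.card_addPoint]
    omega

lemma GeneratedInFiniteDegrees.derivative :
    GeneratedInFiniteDegrees V → GeneratedInFiniteDegrees ((FIMod.derivative R).obj V)
  | ⟨n, hn⟩ => ⟨n, generatedBelow_derivative_iff.2 (hn.mono n.le_succ)⟩

lemma GeneratedInFiniteDegrees.of_derivative :
    GeneratedInFiniteDegrees ((FIMod.derivative R).obj V) → GeneratedInFiniteDegrees V
  | ⟨n, hn⟩ => ⟨n + 1, generatedBelow_derivative_iff.1 hn⟩

lemma GeneratedBelow.vanishesFrom_kerShift (hV : GeneratedBelow n (kerShift V)) :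
    VanishesFrom n (kerShift V) := by
  intro S hS
  have hbot : fromProper (kerShift V) S ≤ ⊥ := by
    rw [fromProper_eq_iSup]
    refine iSup_le fun s => ?_
    rintro _ ⟨x, rfl⟩
    have hx : (V.map (FI.inclPoint.app (FI.sub {j | j ≠ s}))).hom
        (((kernel.ι (shiftι V)).app (FI.sub {j | j ≠ s})).hom x) = 0 :=
      (exact_iff.1 (ShortComplex.exact_kernel (shiftι V)) _ _).2 ⟨x, rfl⟩
    have hs : FI.incl {j | j ≠ s} = FI.inclPoint.app _ ≫ FI.fillPoint s := FI.hom_ext fun _ => rfl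
    refine (Submodule.mem_bot R).2 ((mono_iff_injective (kernel.ι (shiftι V))).1 inferInstance S ?_)
    rw [app_map_apply, hs, map_comp_apply, hx, map_zero, map_zero]
  rw [hV S hS] at hbot
  exact isZero_obj_iff.2 fun x => (Submodule.mem_bot R).1 (hbot Submodule.mem_top)

end Derivative

section SplitShift

variable {P Q : FIMod.{u} R}

/-- The natural map from `P` to its shift is a split monomorphism. -/
def SplitShift (P : FIMod.{u} R) : Prop :=
  ∃ r : (shift R).obj P ⟶ P, shiftι P ≫ r = 𝟙 P

lemma SplitShift.mono_shiftι : SplitShift P → Mono (shiftι P)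
  | ⟨_, hr⟩ => mono_of_mono_fac hr

lemma SplitShift.retract (e : Retract P Q) : SplitShift Q → SplitShift P
  | ⟨r, hr⟩ => ⟨(shift R).map e.i ≫ r ≫ e.r, by
      rw [← Category.assoc, shiftι_naturality, Category.assoc, ← Category.assoc (shiftι Q), hr,
        Category.id_comp, e.retract]⟩

/-- The exchange of the two points added by a double shift. -/
def swapPoints (S : FI.{u}) :
    FI.addPoint.obj (FI.addPoint.obj S) ⟶ FI.addPoint.obj (FI.addPoint.obj S) :=
  FI.ofInjective (fun x : Option (Option S.carrier) => match x with
    | none => some none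
    | some none => none
    | some (some s) => some (some s)) (by
      rintro (_ | _ | x) (_ | _ | y) h
      all_goals first | rfl | cases h
      rfl)

/-- The automorphism of a double shift exchanging the two added points. -/
def swapShift (V : FIMod.{u} R) :
    (shift R).obj ((shift R).obj V) ⟶ (shift R).obj ((shift R).obj V) where
  app S := V.map (swapPoints S)
  naturality S T f := by
    change V.map _ ≫ V.map _ = V.map _ ≫ V.map _
    rw [← V.map_comp, ← V.map_comp]
    refine congr_arg V.map (FI.hom_ext ?_)
    rintro (_ | _ | x) <;> rfl

lemma shiftι_shift_comp_swapShift (V : FIMod.{u} R) :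
    shiftι ((shift R).obj V) ≫ swapShift V = (shift R).map (shiftι V) := by
  ext1
  funext S
  refine (V.map_comp _ _).symm.trans (congr_arg V.map (FI.hom_ext ?_))
  rintro (_ | x) <;> rfl

lemma shift_map_shiftι_comp_swapShift (V : FIMod.{u} R) :
    (shift R).map (shiftι V) ≫ swapShift V = shiftι ((shift R).obj V) := by
  ext1
  funext S
  refine (V.map_comp _ _).symm.trans (congr_arg V.map (FI.hom_ext ?_))
  rintro (_ | x) <;> rfl

-- The retraction of `ΣΔP` onto `ΔP` is induced by the one of `ΣP`, after exchanging the point added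
-- by `Σ` with the point added in the definition of `Δ`.
lemma SplitShift.derivative : SplitShift P → SplitShift ((derivative R).obj P) := by
  rintro ⟨r, hr⟩
  have w : (shift R).map (shiftι P) ≫ swapShift P ≫ (shift R).map r ≫ shiftπ P = 0 := by
    rw [← Category.assoc, shift_map_shiftι_comp_swapShift, ← Category.assoc, shiftι_naturality,
      Category.assoc, shiftι_shiftπ, comp_zero]
  have hexact := (exact_shiftι_shiftπ P).map (shift R)
  have : Epi ((ShortComplex.mk _ _ (shiftι_shiftπ P)).map (shift R)).g :=
    inferInstanceAs (Epi ((shift R).map (shiftπ P)))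
  obtain ⟨r', hr'⟩ : ∃ r', (shift R).map (shiftπ P) ≫ r' = _ := ⟨hexact.desc _ w, hexact.g_desc _ w⟩
  refine ⟨r', ?_⟩
  rw [← cancel_epi (shiftπ P), ← Category.assoc, ← shiftι_naturality, Category.assoc, hr',
    ← Category.assoc, shiftι_shift_comp_swapShift, ← Category.assoc, ← Functor.map_comp, hr,
    CategoryTheory.Functor.map_id, Category.id_comp, Category.comp_id]

end SplitShift

end FIMod

section Snake

variable {C : Type*} [Category* C] [Abelian C]

/-- The input of the snake lemma given by a morphism of short exact sequences. -/
noncomputable def snakeInputOfHom {S T : ShortComplex C} (v : S ⟶ T) (hS : S.ShortExact)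
    (hT : T.ShortExact) : ShortComplex.SnakeInput C where
  L₀ := ShortComplex.mk (kernel.map v.τ₁ v.τ₂ S.f T.f v.comm₁₂)
    (kernel.map v.τ₂ v.τ₃ S.g T.g v.comm₂₃) (by ext; simp)
  L₁ := S
  L₂ := T
  L₃ := ShortComplex.mk (cokernel.map v.τ₁ v.τ₂ S.f T.f v.comm₁₂)
    (cokernel.map v.τ₂ v.τ₃ S.g T.g v.comm₂₃) (by ext; simp)
  v₀₁ :=
    { τ₁ := kernel.ι _
      τ₂ := kernel.ι _
      τ₃ := kernel.ι _ }
  v₁₂ := v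
  v₂₃ :=
    { τ₁ := cokernel.π _
      τ₂ := cokernel.π _
      τ₃ := cokernel.π _ }
  w₀₂ := by ext <;> simp
  w₁₃ := by ext <;> simp
  h₀ := ShortComplex.isLimitOfIsLimitπ _
    ((KernelFork.isLimitMapConeEquiv _ ShortComplex.π₁).symm (kernelIsKernel v.τ₁))
    ((KernelFork.isLimitMapConeEquiv _ ShortComplex.π₂).symm (kernelIsKernel v.τ₂))
    ((KernelFork.isLimitMapConeEquiv _ ShortComplex.π₃).symm (kernelIsKernel v.τ₃))
  h₃ := ShortComplex.isColimitOfIsColimitπ _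
    ((CokernelCofork.isColimitMapCoconeEquiv _ ShortComplex.π₁).symm (cokernelIsCokernel v.τ₁))
    ((CokernelCofork.isColimitMapCoconeEquiv _ ShortComplex.π₂).symm (cokernelIsCokernel v.τ₂))
    ((CokernelCofork.isColimitMapCoconeEquiv _ ShortComplex.π₃).symm (cokernelIsCokernel v.τ₃))
  L₁_exact := hS.exact
  epi_L₁_g := hS.epi_g
  L₂_exact := hT.exact
  mono_L₂_f := hT.mono_f

end Snake

namespace FIMod

variable {R : Type} [CommRing R]

section DerivativeExactness

variable {T : ShortComplex (FIMod.{u} R)}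

/-- The snake lemma for a short exact sequence and its shift. -/
noncomputable def shiftSnakeInput (hT : T.ShortExact) :
    ShortComplex.SnakeInput (FIMod.{u} R) :=
  snakeInputOfHom (T := T.map (shift R))
    { τ₁ := shiftι T.X₁
      τ₂ := shiftι T.X₂
      τ₃ := shiftι T.X₃
      comm₁₂ := shiftι_naturality T.f
      comm₂₃ := shiftι_naturality T.g } hT (hT.map_of_exact (shift.{u} R))

instance : PreservesFiniteColimits (derivative.{u} R) := by
  refine ((derivative.{u} R).preservesFiniteColimits_tfae.out 0 3 :).1 fun T hT => ?_
  have : Epi ((shift R).map T.g) := (hT.map_of_exact (shift.{u} R)).epi_g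
  have : Epi ((shift R).map T.g ≫ shiftπ T.X₃) := epi_comp _ _
  exact ⟨(shiftSnakeInput hT).L₃_exact, epi_of_epi_fac (shiftπ_naturality T.g)⟩

lemma shortExact_map_derivative (hT : T.ShortExact) [Mono (shiftι T.X₃)] :
    (T.map (derivative R)).ShortExact where
  exact := (shiftSnakeInput hT).L₃_exact
  mono_f := (shiftSnakeInput hT).L₂'_exact.mono_g <|
    (isZero_kernel_of_mono (shiftι T.X₃)).eq_of_src _ _
  epi_g := have := hT.epi_g; (derivative.{u} R).map_epi T.g

section Kernel

variable {P V : FIMod.{u} R} (g : P ⟶ V)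

lemma mono_shiftι_kernel [Mono (shiftι P)] : Mono (shiftι (kernel g)) := by
  have : Mono (shiftι (kernel g) ≫ (shift R).map (kernel.ι g)) := by
    rw [shiftι_naturality]
    exact mono_comp _ _
  exact mono_of_mono _ ((shift R).map (kernel.ι g))

variable [Epi g]

instance epi_kernelComparison_derivative : Epi (kernelComparison g (derivative R)) :=
  (shiftSnakeInput (shortExact_kernel g)).L₃_exact.epi_kernelLift

/-- The connecting isomorphism: `Δ` takes `ker g` to an extension of `ker (Δg)` by
`ker (V ⟶ ΣV)` when `P ⟶ ΣP` is injective. -/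
noncomputable def kerShiftIso [Mono (shiftι P)] :
    kerShift V ≅ kernel (kernelComparison g (derivative R)) :=
  let s := shiftSnakeInput (shortExact_kernel g)
  have : Mono s.L₂'.f := s.L₁'_exact.mono_g ((isZero_kernel_of_mono (shiftι P)).eq_of_src _ _)
  let e : kerShift V ≅ kernel ((derivative R).map (kernel.ι g)) :=
    IsLimit.conePointUniqueUpToIso (s := KernelFork.ofι s.L₂'.f s.L₂'.zero)
      s.L₂'_exact.fIsKernel (limit.isLimit _)
  e ≪≫ kernelIsoOfEq (kernelComparison_comp_ι g (derivative R)).symm ≪≫ kernelCompMono _ _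

end Kernel

end DerivativeExactness

section PresentationInFiniteDegrees

variable {V W : FIMod.{u} R} {n : ℕ}

/-- `W` is generated in finite degrees, and so is the kernel of any epimorphism onto `W` from a
module generated in finite degrees. -/
def RelatedInFiniteDegrees (W : FIMod.{u} R) : Prop :=
  GeneratedInFiniteDegrees W ∧ ∀ ⦃V : FIMod.{u} R⦄ (g : V ⟶ W) [Epi g],
    GeneratedInFiniteDegrees V → GeneratedInFiniteDegrees (kernel g)

namespace RelatedInFiniteDegrees

lemma generatedInFiniteDegrees_X₁ {T : ShortComplex (FIMod.{u} R)} (hT : T.ShortExact)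
    (h₃ : RelatedInFiniteDegrees T.X₃) (h₂ : GeneratedInFiniteDegrees T.X₂) :
    GeneratedInFiniteDegrees T.X₁ :=
  have := hT.epi_g
  (h₃.2 T.g h₂).of_epi
    (IsLimit.conePointUniqueUpToIso (kernelIsKernel T.g) hT.fIsKernel).hom

lemma of_kernel (g : V ⟶ W) [Epi g] (hV : RelatedInFiniteDegrees (kernel g))
    (hW : RelatedInFiniteDegrees W) : RelatedInFiniteDegrees V :=
  ⟨.of_exact (shortExact_kernel g).exact hV.1 hW.1, fun _ e _ hE =>
    hV.generatedInFiniteDegrees_X₁ (shortExact_kernel_map_comp e g)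
      (have := epi_comp e g; hW.2 (e ≫ g) hE)⟩

lemma of_derivative (hV : GeneratedInFiniteDegrees V) [Mono (shiftι V)]
    (h : RelatedInFiniteDegrees ((derivative R).obj V)) : RelatedInFiniteDegrees V :=
  ⟨hV, fun _ g _ hW => .of_derivative <|
    h.generatedInFiniteDegrees_X₁ (shortExact_map_derivative (shortExact_kernel g))
      hW.derivative⟩

end RelatedInFiniteDegrees

lemma VanishesFrom.relatedInFiniteDegrees (hV : VanishesFrom n V) : RelatedInFiniteDegrees V := by
  refine ⟨⟨n, fun S hS => eq_top_iff.2 fun x _ => ?_⟩, fun _ g _ ⟨m, hm⟩ =>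
    ⟨_, hm.X₁_of_shortExact (shortExact_kernel g) hV⟩⟩
  rw [isZero_obj_iff.1 (hV S hS) x]
  exact zero_mem _

section Kernel

variable {P : FIMod.{u} R} (g : P ⟶ V) [Epi g]

lemma exists_vanishesFrom_kerShift_of_kernel [Mono (shiftι P)]
    (hg : GeneratedInFiniteDegrees (kernel g))
    (hΔg : RelatedInFiniteDegrees (kernel ((derivative R).map g))) :
    ∃ m, VanishesFrom m (kerShift V) :=
  let ⟨m, hm⟩ := (hΔg.2 (kernelComparison g (derivative R)) hg.derivative).of_epi
    (kerShiftIso g).inv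
  ⟨m, hm.vanishesFrom_kerShift⟩

lemma GeneratedInFiniteDegrees.kernel_derivative_map (hg : GeneratedInFiniteDegrees (kernel g)) :
    GeneratedInFiniteDegrees (kernel ((FIMod.derivative R).map g)) :=
  hg.derivative.of_epi (kernelComparison g (FIMod.derivative R))

lemma relatedInFiniteDegrees_kernel (hP : SplitShift P) (hn : GeneratedBelow n P)
    (hg : GeneratedInFiniteDegrees (kernel g)) : RelatedInFiniteDegrees (kernel g) := by
  induction n generalizing P V with
  | zero =>
    have : VanishesFrom 0 P := fun S _ => isZero_obj_iff.2 (eq_zero_of_generatedBelow_zero hn S)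
    exact (this.of_mono (kernel.ι g)).relatedInFiniteDegrees
  | succ n ih =>
    have hΔg := ih ((derivative R).map g) hP.derivative (generatedBelow_derivative_iff.2 hn)
      (hg.kernel_derivative_map g)
    have := hP.mono_shiftι
    have := mono_shiftι_kernel g
    obtain ⟨m, hm⟩ := exists_vanishesFrom_kerShift_of_kernel g hg hΔg
    refine .of_derivative hg <| .of_kernel (kernelComparison g (derivative R)) ?_ hΔg
    exact (hm.of_epi (kerShiftIso g).hom).relatedInFiniteDegrees

end Kernel

/-- `V` is a quotient of a module generated in finite degrees, split in the sense of `SplitShift`,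
by a submodule generated in finite degrees. -/
def SplitPresented (V : FIMod.{u} R) : Prop :=
  ∃ (P : FIMod.{u} R) (g : P ⟶ V), Epi g ∧ SplitShift P ∧ GeneratedInFiniteDegrees P ∧
    GeneratedInFiniteDegrees (kernel g)

namespace SplitPresented

lemma exists_vanishesFrom_kerShift :
    SplitPresented V → ∃ m, VanishesFrom m (kerShift V) := by
  rintro ⟨P, g, _, hP, ⟨n, hn⟩, hg⟩
  have := hP.mono_shiftι
  exact exists_vanishesFrom_kerShift_of_kernel g hg <|
    relatedInFiniteDegrees_kernel _ hP.derivative (generatedBelow_derivative_iff.2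
      (hn.mono n.le_succ)) (hg.kernel_derivative_map g)

lemma derivative : SplitPresented V → SplitPresented ((derivative R).obj V) := by
  rintro ⟨P, g, _, hP, hP', hg⟩
  exact ⟨_, (FIMod.derivative R).map g, inferInstance, hP.derivative, hP'.derivative,
    hg.kernel_derivative_map g⟩

lemma iterDerivative (hV : SplitPresented V) : ∀ a, SplitPresented ((iterDerivative R a).obj V)
  | 0 => hV
  | a + 1 => (hV.iterDerivative a).derivative

end SplitPresented

end PresentationInFiniteDegrees

end FIMod

/-! ### Free modules -/

lemma FI.exists_comp_inclPoint_iff {S T : FI.{u}} {f : S ⟶ FI.addPoint.obj T} :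
    (∃ g, g ≫ FI.inclPoint.app T = f) ↔ none ∉ Set.range (FI.fn f) := by
  constructor
  · rintro ⟨g, rfl⟩ ⟨x, hx⟩
    cases hx
  · intro h
    refine FI.exists_comp_eq ?_
    rintro y ⟨x, rfl⟩
    exact Option.ne_none_iff_exists.1 fun hx => h ⟨x, hx⟩

namespace FIMod

variable {R : Type} [CommRing R]

section Free

variable {A : Type u} {s : A → FI.{u}} {V : FIMod.{u} R} {S T : FI.{u}}

/-- The effect of an injection on the basis of a free `FI`-module. -/
def compBasis (s : A → FI.{u}) (f : S ⟶ T) (p : Σ a, s a ⟶ S) : Σ a, s a ⟶ T :=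
  ⟨p.1, p.2 ≫ f⟩

lemma compBasis_comp {U : FI.{u}} (f : S ⟶ T) (g : T ⟶ U) :
    compBasis s (f ≫ g) = compBasis s g ∘ compBasis s f :=
  funext fun p => congr_arg (Sigma.mk p.1) (Category.assoc p.2 f g).symm

lemma compBasis_injective (f : S ⟶ T) : Function.Injective (compBasis s f) := by
  rintro ⟨a, i⟩ ⟨b, j⟩ h
  obtain ⟨rfl, h⟩ := Sigma.mk.inj_iff.1 h
  exact congr_arg (Sigma.mk a) <| FI.hom_ext fun x => FI.fn_injective f <|
    congr_fun (congr_arg FI.fn (eq_of_heq h)) x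

lemma mem_range_compBasis_inclPoint_iff {p : Σ a, s a ⟶ FI.addPoint.obj S} :
    p ∈ Set.range (compBasis s (FI.inclPoint.app S)) ↔ none ∉ Set.range (FI.fn p.2) := by
  obtain ⟨a, i⟩ := p
  rw [← FI.exists_comp_inclPoint_iff]
  constructor
  · rintro ⟨⟨b, j⟩, h⟩
    obtain ⟨rfl, h⟩ := Sigma.mk.inj_iff.1 h
    exact ⟨j, eq_of_heq h⟩
  · rintro ⟨j, h⟩
    exact ⟨⟨a, j⟩, congr_arg (Sigma.mk a) h⟩

variable (R s) in
/-- The free `FI`-module on the generators `a : A`, where `a` lives on the finite set `s a`: the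
direct sum of the linearized representable functors `R[Hom (s a, -)]`. -/
noncomputable def free : FIMod.{u} R where
  obj S := ModuleCat.of R ((Σ a, s a ⟶ S) →₀ R)
  map f := ModuleCat.ofHom (Finsupp.lmapDomain R R (compBasis s f))
  map_id S := by
    rw [show compBasis s (𝟙 S) = id from
      funext fun p => congr_arg (Sigma.mk p.1) (Category.comp_id p.2), Finsupp.lmapDomain_id]
    rfl
  map_comp f g := by
    rw [compBasis_comp, Finsupp.lmapDomain_comp]
    rfl

variable (R s) in
/-- The generator of the free `FI`-module `free R s` indexed by `a`. -/
noncomputable def generator (a : A) : (free R s).obj (s a) :=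
  Finsupp.single (⟨a, 𝟙 (s a)⟩ : Σ a', s a' ⟶ s a) (1 : R)

lemma free_map_single {p : Σ a, s a ⟶ S} (f : S ⟶ T) (r : R) :
    ((free R s).map f).hom (Finsupp.single p r) = Finsupp.single (compBasis s f p) r :=
  Finsupp.mapDomain_single

lemma free_map_generator {a : A} (f : s a ⟶ S) :
    ((free R s).map f).hom (generator R s a) =
      Finsupp.single (⟨a, f⟩ : Σ a', s a' ⟶ S) (1 : R) := by
  rw [generator, free_map_single, compBasis, Category.id_comp]

lemma free_hom_ext {f g : free R s ⟶ V}
    (h : ∀ a, (f.app (s a)).hom (generator R s a) = (g.app (s a)).hom (generator R s a)) :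
    f = g := by
  ext1
  funext S
  ext1
  refine Finsupp.lhom_ext' fun p => LinearMap.ext_ring ?_
  change (f.app S).hom (Finsupp.single p 1) = (g.app S).hom (Finsupp.single p 1)
  rw [← free_map_generator, app_map_apply, app_map_apply, h]

/-- The morphism out of a free `FI`-module given by the images of the generators. -/
noncomputable def freeDesc (v : ∀ a, V.obj (s a)) : free R s ⟶ V where
  app S := ModuleCat.ofHom (Finsupp.linearCombination R fun p => (V.map p.2).hom (v p.1))
  naturality S T f := by
    ext1
    refine Finsupp.lhom_ext' fun p => LinearMap.ext_ring ?_
    change Finsupp.linearCombination R _ (((free R s).map f).hom (Finsupp.single p 1)) =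
      (V.map f).hom (Finsupp.linearCombination R _ (Finsupp.single p 1))
    rw [free_map_single, Finsupp.linearCombination_single, Finsupp.linearCombination_single,
      one_smul, one_smul, compBasis, map_comp_apply]

lemma freeDesc_generator (v : ∀ a, V.obj (s a)) (a : A) :
    ((freeDesc v).app (s a)).hom (generator R s a) = v a := by
  change Finsupp.linearCombination R _ (Finsupp.single _ 1) = v a
  rw [Finsupp.linearCombination_single, one_smul, V.map_id]
  rfl

instance projective_free : Projective (free R s) where
  factors f g _ := by
    choose v hv using fun a => (epi_iff_surjective g).1 inferInstance (s a)
      ((f.app (s a)).hom (generator R s a))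
    refine ⟨freeDesc v, free_hom_ext fun a => ?_⟩
    rw [← hv a, ← freeDesc_generator v a]
    rfl

lemma generatedBelow_free {n : ℕ} (h : ∀ a, Nat.card (s a).carrier < n) :
    GeneratedBelow n (free R s) := by
  intro S hS
  refine eq_top_iff.2 fun x _ => ?_
  induction x using Finsupp.induction_linear with
  | zero => exact zero_mem _
  | add x y hx hy => exact add_mem (hx trivial) (hy trivial)
  | single p r =>
    obtain ⟨x, hx⟩ : ∃ x, x ∉ Set.range (FI.fn p.2) := by
      by_contra! hp
      exact absurd (Nat.card_le_card_of_surjective _ hp) (not_le.2 ((h p.1).trans_le hS))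
    refine range_map_le_fromProper (free R s) hx
      ⟨Finsupp.single (⟨p.1, 𝟙 _⟩ : Σ a, s a ⟶ s p.1) r, ?_⟩
    rw [free_map_single, compBasis, Category.id_comp]

lemma lcomapDomain_inclPoint_map (f : S ⟶ T) (x : (Σ a, s a ⟶ FI.addPoint.obj S) →₀ R) :
    Finsupp.lcomapDomain (R := R) _ (compBasis_injective (s := s) (FI.inclPoint.app T))
        (Finsupp.mapDomain (compBasis s (FI.addPoint.map f)) x) =
      Finsupp.mapDomain (compBasis s f)
        (Finsupp.lcomapDomain (R := R) _ (compBasis_injective (FI.inclPoint.app S)) x) := by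
  induction x using Finsupp.induction_linear with
  | zero => simp only [Finsupp.mapDomain_zero, map_zero]
  | add x y hx hy => simp only [Finsupp.mapDomain_add, map_add, hx, hy]
  | single p r =>
    rw [Finsupp.mapDomain_single, Finsupp.lcomapDomain_apply, Finsupp.lcomapDomain_apply]
    by_cases hp : p ∈ Set.range (compBasis s (FI.inclPoint.app S))
    · obtain ⟨q, rfl⟩ := hp
      have hq : compBasis s (FI.addPoint.map f) (compBasis s (FI.inclPoint.app S) q) =
          compBasis s (FI.inclPoint.app T) (compBasis s f q) := rfl
      rw [hq, Finsupp.comapDomain_single, Finsupp.comapDomain_single, Finsupp.mapDomain_single]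
    · have hfp : compBasis s (FI.addPoint.map f) p ∉
          Set.range (compBasis s (FI.inclPoint.app T)) := by
        rw [mem_range_compBasis_inclPoint_iff, not_not] at hp ⊢
        obtain ⟨x, hx⟩ := hp
        exact ⟨x, congr_arg (FI.fn (FI.addPoint.map f)) hx⟩
      rw [Finsupp.comapDomain_single_of_not_mem_range hfp,
        Finsupp.comapDomain_single_of_not_mem_range hp, Finsupp.mapDomain_zero]

/-- The retraction kills the injections `s a ⟶ S ⊔ {*}` that hit the added point. -/
lemma splitShift_free : SplitShift (free R s) := by
  refine ⟨⟨fun S => ModuleCat.ofHom (Finsupp.lcomapDomain (M := R) _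
    (compBasis_injective (s := s) (FI.inclPoint.app S))), fun S T f => ?_⟩, ?_⟩
  · ext1
    exact LinearMap.ext (lcomapDomain_inclPoint_map f)
  · ext1
    funext S
    ext1
    exact LinearMap.ext (Finsupp.leftInverse_lcomapDomain_mapDomain (R := R) (M := R) _
      (compBasis_injective (FI.inclPoint.app S)))

lemma epi_freeDesc {v : ∀ a, V.obj (s a)}
    (h : ∀ S, (∀ y : V.obj S, ∃ a, ∃ f : s a ⟶ S, (V.map f).hom (v a) = y) ∨ fromProper V S = ⊤) :
    Epi (freeDesc v) := by
  refine (epi_iff_surjective _).2 fun S => ?_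
  induction hn : Nat.card S.carrier using Nat.strong_induction_on generalizing S with
  | _ n ih =>
    obtain hS | hS := h S
    · intro y
      obtain ⟨a, f, rfl⟩ := hS y
      exact ⟨((free R s).map f).hom (generator R s a), by
        rw [app_map_apply, freeDesc_generator]⟩
    · rw [← LinearMap.range_eq_top, eq_top_iff, ← hS, fromProper_eq_iSup]
      refine iSup_le fun x => ?_
      have hcard := FI.card_sub_ne_add_one x
      have hsurj := ih _ (by omega) (FI.sub {j | j ≠ x}) rfl
      rw [← Submodule.map_top, ← LinearMap.range_eq_top.2 hsurj, ← map_range_map]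
      exact LinearMap.map_le_range

lemma exists_epi_free (V : FIMod.{u} R) (p : ℕ → Prop)
    (h : ∀ S : FI.{u}, p (Nat.card S.carrier) ∨ fromProper V S = ⊤) :
    ∃ (A : Type u) (s : A → FI.{u}) (g : free R s ⟶ V),
      Epi g ∧ ∀ a, p (Nat.card (s a).carrier) := by
  refine ⟨Σ k : {k // p (Nat.card (std.{u}.obj k).carrier)}, V.obj (std.obj k.1),
    fun a => std.obj a.1.1, freeDesc Sigma.snd, epi_freeDesc fun S => (h S).imp_left fun hS y => ?_,
    fun a => a.1.2⟩
  obtain ⟨k, ⟨e⟩⟩ := exists_iso_std S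
  have hk : p (Nat.card (std.{u}.obj k).carrier) := by
    rwa [(FI.card_le_of_hom e.hom).antisymm (FI.card_le_of_hom e.inv)]
  refine ⟨⟨⟨k, hk⟩, (V.map e.inv).hom y⟩, e.hom, ?_⟩
  rw [← map_comp_apply, e.inv_hom_id, V.map_id]
  rfl

lemma splitShift_of_projective (P : FIMod.{u} R) [Projective P] : SplitShift P :=
  let ⟨_, _, g, _, _⟩ := exists_epi_free P (fun _ => True) fun _ => .inl trivial
  splitShift_free.retract ⟨Projective.factorThru (𝟙 P) g, g, Projective.factorThru_comp _ _⟩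

end Free

section Homology

variable {n m : ℕ} {V : FIMod.{u} R} {S : FI.{u}}

lemma isZero_homologyZero_obj_iff :
    IsZero ((homologyZero R ⋙ eval R S).obj V) ↔ fromProper V S = ⊤ :=
  ModuleCat.isZero_iff_subsingleton.trans Submodule.Quotient.subsingleton_iff

instance (S : FI.{u}) : PreservesFiniteColimits (homologyZero.{u} R ⋙ eval R S) := by
  refine ((homologyZero R ⋙ eval R S).preservesFiniteColimits_tfae.out 0 3 :).1 fun T hT => ?_
  have := hT.epi_g
  have hexact := exact_iff.1 hT.exact S
  have hsurj := (epi_iff_surjective T.g).1 inferInstance S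
  constructor
  · refine (ShortComplex.ShortExact.moduleCat_exact_iff_function_exact _).2 <|
      (hexact.exact_mapQ_iff (fromProper_le_comap_app T.f S) (fromProper_le_comap_app T.g S)).2 ?_
    exact inf_le_right.trans (map_fromProper T.g S).ge
  · refine (ModuleCat.epi_iff_surjective _).2 <| LinearMap.range_eq_top.1 ?_
    refine (Submodule.range_mapQ _ _ (T.g.app S).hom (fromProper_le_comap_app T.g S)).trans ?_
    rw [LinearMap.range_eq_top.2 hsurj, Submodule.map_top, Submodule.range_mkQ]
    rfl

lemma isZero_homology_obj_iff {i : ℕ} :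
    IsZero (((homology R i).obj V).obj S) ↔
      IsZero (((homologyZero R ⋙ eval R S).leftDerived i).obj V) :=
  (leftDerivedCompObjIso (homologyZero R) (eval R S) i V).isZero_iff.symm

lemma generatedBelow_iff_vanishesFrom_homology_zero :
    GeneratedBelow n V ↔ VanishesFrom n ((homology R 0).obj V) :=
  forall₂_congr fun S _ => by
    rw [isZero_homology_obj_iff,
      ((homologyZero R ⋙ eval R S).leftDerivedZeroIsoSelf.app V).isZero_iff,
      isZero_homologyZero_obj_iff]

lemma splitPresented_of_vanishesFrom (h₀ : VanishesFrom n ((homology R 0).obj V))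
    (h₁ : VanishesFrom m ((homology R 1).obj V)) : SplitPresented V := by
  obtain ⟨A, s, g, _, hs⟩ := exists_epi_free V (· < n) fun S =>
    (lt_or_ge _ n).imp_right (generatedBelow_iff_vanishesFrom_homology_zero.2 h₀ S)
  have hfree := generatedBelow_free (R := R) hs
  refine ⟨free R s, g, ‹_›, splitShift_free, ⟨n, hfree⟩, max n m, fun S hS => ?_⟩
  have : Projective (ShortComplex.mk (kernel.ι g) g (kernel.condition g)).X₂ :=
    projective_free
  have hmono := (isZero_leftDerived_one_iff_mono_map (homologyZero R ⋙ eval R S)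
    (shortExact_kernel g)).1 (isZero_homology_obj_iff.1 (h₁ S (le_of_max_le_right hS)))
  exact isZero_homologyZero_obj_iff.1 <|
    (isZero_homologyZero_obj_iff.2 (hfree S (le_of_max_le_left hS))).of_mono
      ((homologyZero R ⋙ eval R S).map (kernel.ι g))

end Homology

end FIMod

/-! ### Derived functors of iterated derivatives -/

namespace FIMod

variable {R : Type} [CommRing R]

instance preservesFiniteColimits_iterDerivative :
    ∀ a : ℕ, PreservesFiniteColimits (iterDerivative.{u} R a)
  | 0 => inferInstanceAs (PreservesFiniteColimits (𝟭 (FIMod.{u} R)))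
  | a + 1 =>
    have := preservesFiniteColimits_iterDerivative a
    comp_preservesFiniteColimits (iterDerivative.{u} R a) (derivative R)

lemma SplitShift.iterDerivative {P : FIMod.{u} R} (hP : SplitShift P) :
    ∀ a, SplitShift ((iterDerivative R a).obj P)
  | 0 => hP
  | a + 1 => (hP.iterDerivative a).derivative

lemma injective_derivative_map {T : ShortComplex (FIMod.{u} R)} {S : FI.{u}} (hT : T.Exact)
    (hf : Function.Injective (T.f.app (FI.addPoint.obj S)).hom)
    (hι : Function.Injective ((shiftι T.X₃).app S).hom) :
    Function.Injective (((derivative R).map T.f).app S).hom := by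
  have hexact (V : FIMod.{u} R) := exact_iff.1 (exact_shiftι_shiftπ V) S
  refine (injective_iff_map_eq_zero _).2 fun x hx => ?_
  obtain ⟨x, rfl⟩ := (epi_iff_surjective (shiftπ T.X₁)).1 inferInstance S x
  obtain ⟨y, hy⟩ : ∃ y, ((shiftι T.X₂).app S).hom y = (((shift R).map T.f).app S).hom x := by
    refine (hexact T.X₂ _).1 (Eq.trans ?_ hx)
    exact congr_arg (fun t => (t.app S).hom x) (shiftπ_naturality T.f).symm
  obtain ⟨z, rfl⟩ : ∃ z, (T.f.app S).hom z = y := by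
    refine (exact_iff.1 hT S y).1 (hι ?_)
    rw [map_zero]
    refine (app_map_apply T.g (FI.inclPoint.app S) y).symm.trans ?_
    exact (congr_arg (T.g.app _).hom hy).trans ((exact_iff.1 hT _ _).2 ⟨x, rfl⟩)
  refine (hexact T.X₁ _).2 ⟨z, hf (Eq.trans ?_ hy)⟩
  exact app_map_apply T.f (FI.inclPoint.app S) z

lemma injective_shiftι_app_of_injective {V W : FIMod.{u} R} {S : FI.{u}} {φ : V ⟶ W}
    (hW : Mono (shiftι W)) (hφ : Function.Injective (φ.app S).hom) :
    Function.Injective ((shiftι V).app S).hom := by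
  refine fun x y hxy => hφ ((mono_iff_injective _).1 hW S ?_)
  have hcomm (z : V.obj S) : ((shiftι W).app S).hom ((φ.app S).hom z) =
      (φ.app (FI.addPoint.obj S)).hom (((shiftι V).app S).hom z) :=
    (app_map_apply φ (FI.inclPoint.app S) z).symm
  rw [hcomm, hcomm, hxy]

section DerivedDerivative

variable {a : ℕ} {V : FIMod.{u} R} {S : FI.{u}}

lemma isZero_derivedDerivative_obj_iff {i : ℕ} :
    IsZero (((derivedDerivative R a i).obj V).obj S) ↔
      IsZero (((iterDerivative R a ⋙ eval R S).leftDerived i).obj V) :=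
  (leftDerivedCompObjIso (iterDerivative R a) (eval R S) i V).isZero_iff.symm

lemma isZero_derivedDerivative_one_iff {P : FIMod.{u} R} [Projective P] (g : P ⟶ V) [Epi g] :
    IsZero (((derivedDerivative R a 1).obj V).obj S) ↔
      Function.Injective (((iterDerivative R a).map (kernel.ι g)).app S).hom := by
  have : Projective (ShortComplex.mk (kernel.ι g) g (kernel.condition g)).X₂ := ‹Projective P›
  have : PreservesFiniteColimits (iterDerivative R a ⋙ eval R S) :=
    comp_preservesFiniteColimits _ _
  rw [isZero_derivedDerivative_obj_iff, isZero_leftDerived_one_iff_mono_map _ (shortExact_kernel g)]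
  exact ModuleCat.mono_iff_injective _

lemma isZero_derivedDerivative_add_two_iff {P : FIMod.{u} R} [Projective P] (g : P ⟶ V) [Epi g]
    (i : ℕ) : IsZero (((derivedDerivative R a (i + 2)).obj V).obj S) ↔
      IsZero (((derivedDerivative R a (i + 1)).obj (kernel g)).obj S) := by
  have : Projective (ShortComplex.mk (kernel.ι g) g (kernel.condition g)).X₂ := ‹Projective P›
  rw [isZero_derivedDerivative_obj_iff, isZero_derivedDerivative_obj_iff,
    isZero_leftDerived_add_two_iff _ (shortExact_kernel g)]

lemma isZero_derivedDerivative_zero_succ (V : FIMod.{u} R) (S : FI.{u}) (i : ℕ) :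
    IsZero (((derivedDerivative R 0 (i + 1)).obj V).obj S) := by
  induction i generalizing V with
  | zero =>
    exact (isZero_derivedDerivative_one_iff (Projective.π V)).2
      ((mono_iff_injective (kernel.ι (Projective.π V))).1 inferInstance S)
  | succ i ih => exact (isZero_derivedDerivative_add_two_iff (Projective.π V) i).2 (ih _)

lemma isZero_derivedDerivative_succ_one
    (h : IsZero (((derivedDerivative R a 1).obj V).obj (FI.addPoint.obj S)))
    (hι : Function.Injective ((shiftι ((iterDerivative R a).obj V)).app S).hom) :
    IsZero (((derivedDerivative R (a + 1) 1).obj V).obj S) := by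
  have hexact := (((iterDerivative.{u} R a).preservesFiniteColimits_tfae.out 3 0 :).1 inferInstance
    _ (shortExact_kernel (Projective.π V))).1
  rw [isZero_derivedDerivative_one_iff (Projective.π V)] at h ⊢
  have hinj := injective_derivative_map hexact h hι
  exact hinj

lemma isZero_derivedDerivative_succ_add_two {i : ℕ}
    (h : IsZero (((derivedDerivative R a (i + 2)).obj V).obj (FI.addPoint.obj S)))
    (h' : IsZero (((derivedDerivative R a (i + 1)).obj V).obj S)) :
    IsZero (((derivedDerivative R (a + 1) (i + 2)).obj V).obj S) := by
  induction i generalizing V with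
  | zero =>
    have hP := (splitShift_of_projective (Projective.over V)).iterDerivative a
    rw [isZero_derivedDerivative_add_two_iff (Projective.π V)] at h ⊢
    exact isZero_derivedDerivative_succ_one h <| injective_shiftι_app_of_injective hP.mono_shiftι
      ((isZero_derivedDerivative_one_iff (Projective.π V)).1 h')
  | succ i ih =>
    rw [isZero_derivedDerivative_add_two_iff (Projective.π V)] at h h' ⊢
    exact ih h h'

end DerivedDerivative

end FIMod

/-! ### Comparison with local cohomology -/

namespace FIMod

variable {R : Type} [CommRing R]

section Comparison

variable {V : FIMod.{u} R}

lemma exists_localCohomology_of_iterDerivative (hV : SplitPresented V) {a m : ℕ} {S : FI.{u}}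
    (h : ¬ IsZero (((localCohomology R m).obj ((iterDerivative R a).obj V)).obj S)) :
    ∃ (j : ℕ) (T : FI.{u}), j ≤ m + a ∧ ¬ IsZero (((localCohomology R j).obj V).obj T) ∧
      Nat.card S.carrier + m + a ≤ Nat.card T.carrier + j := by
  induction a generalizing m S with
  | zero => exact ⟨m, S, le_rfl, h, le_rfl⟩
  | succ a ih =>
    obtain ⟨n, hn⟩ := (hV.iterDerivative a).exists_vanishesFrom_kerShift
    rcases not_and_or.1 fun hzero => h (isZero_localCohomology_derivative hn hzero.1 hzero.2) with
      hpoint | hdegree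
    · obtain ⟨j, T, hj, hT, hc⟩ := ih hpoint
      rw [FI.card_addPoint] at hc
      exact ⟨j, T, by omega, hT, by omega⟩
    · obtain ⟨j, T, hj, hT, hc⟩ := ih hdegree
      exact ⟨j, T, by omega, hT, by omega⟩

lemma injective_shiftι_app_of_isZero_localCohomology_zero {S : FI.{u}}
    (h : IsZero (((localCohomology R 0).obj V).obj S)) :
    Function.Injective ((shiftι V).app S).hom := by
  rw [isZero_localCohomology_zero_obj_iff, eq_bot_iff] at h
  exact (injective_iff_map_eq_zero _).2 fun x hx => h ⟨_, FI.inclPoint.app S, hx⟩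

lemma exists_localCohomology_of_derivedDerivative (hV : SplitPresented V) {a i : ℕ} {S : FI.{u}}
    (h : ¬ IsZero (((derivedDerivative R a (i + 1)).obj V).obj S)) :
    ∃ (j : ℕ) (T : FI.{u}), j + (i + 1) ≤ a ∧ ¬ IsZero (((localCohomology R j).obj V).obj T) ∧
      Nat.card S.carrier + a ≤ Nat.card T.carrier + j + (i + 1) := by
  induction a generalizing i S with
  | zero => exact absurd (isZero_derivedDerivative_zero_succ V S i) h
  | succ a ih =>
    by_cases hpoint : IsZero (((derivedDerivative R a (i + 1)).obj V).obj (FI.addPoint.obj S))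
    · cases i with
      | zero =>
        obtain ⟨j, T, hj, hT, hc⟩ := exists_localCohomology_of_iterDerivative (a := a) hV
          fun hzero => h <| isZero_derivedDerivative_succ_one hpoint <|
            injective_shiftι_app_of_isZero_localCohomology_zero hzero
        exact ⟨j, T, by omega, hT, by omega⟩
      | succ i =>
        obtain ⟨j, T, hj, hT, hc⟩ := ih fun hzero =>
          h (isZero_derivedDerivative_succ_add_two hpoint hzero)
        exact ⟨j, T, by omega, hT, by omega⟩
    · obtain ⟨j, T, hj, hT, hc⟩ := ih hpoint
      rw [FI.card_addPoint] at hc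
      exact ⟨j, T, by omega, hT, by omega⟩

end Comparison

/-! ### Degrees -/

section Degree

variable {V W : FIMod.{u} R} {S : FI.{u}}

lemma deg_le {d : WithTop ℤ} (hd : -1 ≤ d)
    (h : ∀ S : FI.{u}, d < (Nat.card S.carrier : WithTop ℤ) → IsZero (W.obj S)) : deg W ≤ d :=
  csInf_le ⟨-1, fun _ hx => hx.1⟩ ⟨hd, h⟩

lemma card_le_deg (h : ¬ IsZero (W.obj S)) : (Nat.card S.carrier : WithTop ℤ) ≤ deg W :=
  le_csInf ⟨⊤, le_top, fun _ hS => absurd hS not_top_lt⟩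
    fun _ hd => not_lt.1 fun hlt => h (hd.2 S hlt)

lemma deg_nonneg (h : ¬ IsZero (W.obj S)) : 0 ≤ deg W :=
  (mod_cast Nat.zero_le _ : (0 : WithTop ℤ) ≤ Nat.card S.carrier).trans (card_le_deg h)

lemma exists_not_isZero_of_deg_nonneg (h : 0 ≤ deg W) : ∃ S, ¬ IsZero (W.obj S) := by
  by_contra! hW
  exact absurd (h.trans (deg_le le_rfl fun S _ => hW S)) (by decide)

lemma exists_vanishesFrom_of_deg_ne_top (h : deg W ≠ ⊤) : ∃ n, VanishesFrom n W := by
  obtain ⟨k, hk⟩ := WithTop.ne_top_iff_exists.1 h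
  refine ⟨(k + 1).toNat, fun S hS => ?_⟩
  by_contra hW
  have hle := card_le_deg hW
  rw [← hk] at hle
  have : (Nat.card S.carrier : ℤ) ≤ k := by exact_mod_cast hle
  omega

lemma deg_add_le {c : ℕ} {M : WithTop ℤ} (hS : ¬ IsZero (W.obj S))
    (h : ∀ T : FI.{u}, ¬ IsZero (W.obj T) → ((Nat.card T.carrier + c : ℕ) : WithTop ℤ) ≤ M) :
    deg W + (c : WithTop ℤ) ≤ M := by
  induction M with
  | top => exact le_top
  | coe k =>
    have hcard (T : FI.{u}) (hT : ¬ IsZero (W.obj T)) : (Nat.card T.carrier : ℤ) + c ≤ k := by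
      exact_mod_cast h T hT
    have hk : (-1 : ℤ) ≤ k - c := by have := hcard S hS; omega
    have hdeg : deg W ≤ ((k - c : ℤ) : WithTop ℤ) := by
      refine deg_le (WithTop.coe_le_coe.2 hk) fun T hT => ?_
      by_contra hW
      have hlt : k - c < (Nat.card T.carrier : ℤ) := by exact_mod_cast hT
      have := hcard T hW
      omega
    refine (add_le_add_left hdeg _).trans_eq ?_
    exact_mod_cast congr_arg (fun t : ℤ => (t : WithTop ℤ)) (sub_add_cancel k (c : ℤ))

lemma PresentedInFiniteDegrees.splitPresented (hV : PresentedInFiniteDegrees V) :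
    SplitPresented V :=
  let ⟨_, h₀⟩ := exists_vanishesFrom_of_deg_ne_top hV.1
  let ⟨_, h₁⟩ := exists_vanishesFrom_of_deg_ne_top hV.2
  splitPresented_of_vanishesFrom h₀ h₁

lemma exists_isGreatest_and_deg_add_le {p : ℕ → Prop} {N c e : ℕ} (hp : ∀ j, p j → j ≤ N)
    (hS : ¬ IsZero (W.obj S))
    (hW : ∀ S : FI.{u}, ¬ IsZero (W.obj S) → ∃ (j : ℕ) (T : FI.{u}), p j ∧
      ¬ IsZero (((localCohomology R j).obj V).obj T) ∧
        Nat.card S.carrier + c ≤ Nat.card T.carrier + j + e) :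
    ∃ M : WithTop ℤ,
      IsGreatest {x | ∃ j : ℕ, 0 ≤ h j V ∧ p j ∧ x = h j V + (j : WithTop ℤ) + (e : WithTop ℤ)} M ∧
      deg W + (c : WithTop ℤ) ≤ M := by
  set X := {x | ∃ j : ℕ, 0 ≤ h j V ∧ p j ∧ x = h j V + (j : WithTop ℤ) + (e : WithTop ℤ)}
  have hfin : X.Finite := by
    refine ((Set.finite_Iic N).image fun j => h j V + (j : WithTop ℤ) + (e : WithTop ℤ)).subset ?_
    rintro _ ⟨j, _, hj, rfl⟩
    exact ⟨j, hp j hj, rfl⟩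
  have hne : X.Nonempty := by
    obtain ⟨j, T, hj, hT, -⟩ := hW S hS
    exact ⟨_, j, deg_nonneg hT, hj, rfl⟩
  obtain ⟨M, hM, hmax⟩ := Set.exists_max_image X id hfin hne
  refine ⟨M, ⟨hM, hmax⟩, deg_add_le hS fun S' hS' => ?_⟩
  obtain ⟨j, T, hj, hT, hcard⟩ := hW S' hS'
  calc ((Nat.card S'.carrier + c : ℕ) : WithTop ℤ)
      ≤ (Nat.card T.carrier : WithTop ℤ) + (j : WithTop ℤ) + (e : WithTop ℤ) := by
        exact_mod_cast hcard
    _ ≤ h j V + (j : WithTop ℤ) + (e : WithTop ℤ) := by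
        gcongr
        exact card_le_deg hT
    _ ≤ M := hmax _ ⟨j, deg_nonneg hT, hj, rfl⟩

end Degree

end FIMod

theorem mainTheorem2_general {R : Type} [CommRing R] (V : FIMod.{u} R)
    (hV : FIMod.PresentedInFiniteDegrees V) :
    (∀ a m : ℕ, 0 ≤ FIMod.h m ((FIMod.iterDerivative R a).obj V) →
      ∃ M : WithTop ℤ,
        IsGreatest {x | ∃ j : ℕ, 0 ≤ FIMod.h j V ∧ j ≤ m + a ∧
          x = FIMod.h j V + (j : WithTop ℤ)} M ∧
        FIMod.h m ((FIMod.iterDerivative R a).obj V) + (m : WithTop ℤ) + (a : WithTop ℤ) ≤ M) ∧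
    (∀ a i : ℕ, 1 ≤ i → ¬ IsZero ((FIMod.derivedDerivative R a i).obj V) →
      ∃ M : WithTop ℤ,
        IsGreatest {x | ∃ j : ℕ, 0 ≤ FIMod.h j V ∧ (j : ℤ) ≤ (a : ℤ) - (i : ℤ) ∧
          x = FIMod.h j V + (j : WithTop ℤ) + (i : WithTop ℤ)} M ∧
        FIMod.deg ((FIMod.derivedDerivative R a i).obj V) + (a : WithTop ℤ) ≤ M) := by
  have hsplit := hV.splitPresented
  constructor
  · intro a m hm
    obtain ⟨S, hS⟩ := FIMod.exists_not_isZero_of_deg_nonneg hm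
    have hmax := FIMod.exists_isGreatest_and_deg_add_le (V := V) (p := (· ≤ m + a)) (c := m + a)
      (e := 0) (fun _ hj => hj) hS fun T hT => by
        simpa only [add_zero, add_assoc] using
          FIMod.exists_localCohomology_of_iterDerivative hsplit hT
    simp only [Nat.cast_add, Nat.cast_zero, add_zero, ← add_assoc] at hmax
    exact hmax
  · intro a i hi hne
    obtain ⟨i, rfl⟩ := Nat.exists_eq_add_of_le' hi
    obtain ⟨S, hS⟩ := not_forall.1 (mt (Functor.isZero_iff _).2 hne)
    refine FIMod.exists_isGreatest_and_deg_add_le (N := a) (fun j hj => by omega) hS fun T hT => ?_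
    obtain ⟨j, U, hj, hU, hcard⟩ := FIMod.exists_localCohomology_of_derivedDerivative hsplit hT
    exact ⟨j, U, by omega, hU, hcard⟩

theorem mainTheorem2 (V : FIMod.{u} ℤ) (hV : FIMod.PresentedInFiniteDegrees V) :
    (∀ a m : ℕ, 0 ≤ FIMod.h m ((FIMod.iterDerivative ℤ a).obj V) →
      ∃ M : WithTop ℤ,
        IsGreatest {x | ∃ j : ℕ, 0 ≤ FIMod.h j V ∧ j ≤ m + a ∧ x = FIMod.h j V + (j : WithTop ℤ)} M ∧
        FIMod.h m ((FIMod.iterDerivative ℤ a).obj V) + (m : WithTop ℤ) + (a : WithTop ℤ) ≤ M) ∧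
    (∀ a i : ℕ, 1 ≤ a → 1 ≤ i → ¬ IsZero ((FIMod.derivedDerivative ℤ a i).obj V) →
      ∃ M : WithTop ℤ,
        IsGreatest {x | ∃ j : ℕ, 0 ≤ FIMod.h j V ∧ (j : ℤ) ≤ (a : ℤ) - (i : ℤ) ∧
          x = FIMod.h j V + (j : WithTop ℤ) + (i : WithTop ℤ)} M ∧
        FIMod.deg ((FIMod.derivedDerivative ℤ a i).obj V) + (a : WithTop ℤ) ≤ M) :=
  ⟨(mainTheorem2_general V hV).1, fun a i _ => (mainTheorem2_general V hV).2 a i⟩
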